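/- Let $d\ge 1$. Denote by $\mathcal S_d$ the real symmetric $d\times d$ matrices and by $\mathcal S_d^{+,*}$ the positive definite ones. Let $\mathcal G$ be the set of functions $g:\mathbb R^d\to\mathbb C$ of the form $$g(x)=a\,e^{-\frac12 (x-q)\cdot Q(x-q)}\,e^{i p\cdot (x-q)},\qquad a\in\mathbb C,\ p,q\in\mathbb R^d,\ Q=A+iB,\ A\in\mathcal S_d^{+,*},\ B\in\mathcal S_d ,$$ and, for $\nu=(\nu_1,\dots,\nu_d)\in\mathbb N^d$, let $\mathcal G_\nu=\{Pg : g\in\mathcal G,\ P\in\mathbb C^\nu[x_1,\dots,x_d]\}$, where $\mathbb C^\nu[x_1,\dots,x_d]$ is the space of complex polynomials of degree at most $\nu_j$ in the variable $x_j$ for every $j$. A subset $\Sigma$ of a complex Banach space $E$ is called a *dictionary* in $E$ if (i) $\lambda x\in\Sigma$ for all $x\in\Sigma$ and $\lambda\in\mathbb C$; (ii) $\Sigma$ is closed in the weak topology of $E$; (iii) the linear span of $\Sigma$ is dense in $E$. For $I=(0,T)$ with $T>0$ and a complex Banach space $E$, let $H^1(I,E)$ be the space of $u\in L^2(I,E)$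 with weak derivative $u'\in L^2(I,E)$, with norm $(\|u\|_{L^2}^2+\|u'\|_{L^2}^2)^{1/2}$; for $\Sigma\subset E$, let $H^1(I,\Sigma)$ be the set of $u\in H^1(I,E)$ whose continuous representative satisfies $u(t)\in\Sigma$ for every $t\in I$. **Proposition.** For every $d\ge1$, every $\nu\in\mathbb N^d$ and every $1\le r<\infty$, the set $\mathcal G_\nu$ (functions being identified when they agree almost everywhere) is contained in $L^r(\mathbb R^d)$ and is a dictionary in $L^r(\mathbb R^d)$. Consequently, for every $T>0$, with $I=(0,T)$, the set $H^1(I,\mathcal G_\nu)$ is a dictionary in $H^1(I,L^2(\mathbb R^d))$. -/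

import Mathlib

open MeasureTheory Set
open scoped ENNReal ContDiff Matrix

noncomputable section

/-- A subset `S` of a complex Banach space is a dictionary if it is stable under multiplication by
complex scalars, closed for the weak topology, and has a dense linear span. -/
structure IsDictionary {E : Type*} [NormedAddCommGroup E] [NormedSpace ℂ E] [CompleteSpace E]
    (S : Set E) : Prop where
  smul_mem : ∀ x ∈ S, ∀ c : ℂ, c • x ∈ S
  weakly_closed : IsClosed (toWeakSpace ℂ E '' S)
  dense_span : Dense (Submodule.span ℂ S : Set E)

/-- The complex Gaussian wave packet
`x ↦ a exp(-(1/2) (x - q) · (A + iB) (x - q)) exp(i p · (x - q))` on `ℝ^d`. -/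
def gaussianPacket {d : ℕ} (a : ℂ) (p q : EuclideanSpace ℝ (Fin d))
    (A B : Matrix (Fin d) (Fin d) ℝ) (x : EuclideanSpace ℝ (Fin d)) : ℂ :=
  let Q : Matrix (Fin d) (Fin d) ℂ :=
    A.map Complex.ofReal + Complex.I • B.map Complex.ofReal
  let y : Fin d → ℂ := fun j => ((x j - q j : ℝ) : ℂ)
  a * Complex.exp (-(1 / 2 : ℂ) * (y ⬝ᵥ (Q *ᵥ y)))
    * Complex.exp (Complex.I * ((∑ j, p j * (x j - q j) : ℝ) : ℂ))

/-- The set `𝒢` of Gaussian wave packets on `ℝ^d`. -/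
def gaussianPackets (d : ℕ) : Set (EuclideanSpace ℝ (Fin d) → ℂ) :=
  {g | ∃ (a : ℂ) (p q : EuclideanSpace ℝ (Fin d)) (A B : Matrix (Fin d) (Fin d) ℝ),
    A.PosDef ∧ B.IsSymm ∧ g = gaussianPacket a p q A B}

/-- The set `𝒢_ν` of products `P g` with `g ∈ 𝒢` and `P` a complex polynomial of degree at most
`ν j` in the `j`-th variable, for every `j`. -/
def polyGaussianPackets {d : ℕ} (ν : Fin d → ℕ) : Set (EuclideanSpace ℝ (Fin d) → ℂ) :=
  {f | ∃ P : MvPolynomial (Fin d) ℂ, (∀ j, P.degreeOf j ≤ ν j) ∧ ∃ g ∈ gaussianPackets d,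
    f = fun x => MvPolynomial.eval (fun j => ((x j : ℝ) : ℂ)) P * g x}

/-- `𝒢_ν` as a subset of `L^r(ℝ^d)`: the classes of the elements of `𝒢_ν`. -/
def polyGaussianLp {d : ℕ} (ν : Fin d → ℕ) (r : ℝ≥0∞) :
    Set (Lp ℂ r (volume : Measure (EuclideanSpace ℝ (Fin d)))) :=
  {u | ∃ f ∈ polyGaussianPackets ν, u =ᵐ[volume] f}

/-- `v` is the weak derivative of `u` on the open interval `(0, T)`. -/
def HasWeakDerivOn {E : Type*} [NormedAddCommGroup E] [NormedSpace ℂ E] (T : ℝ)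
    (u v : ℝ → E) : Prop :=
  ∀ φ : ℝ → ℂ, ContDiff ℝ ∞ φ → HasCompactSupport φ → tsupport φ ⊆ Ioo 0 T →
    ∫ t in Ioo 0 T, deriv φ t • u t = -∫ t in Ioo 0 T, φ t • v t

theorem integrable_smul_of_test {E : Type*} [NormedAddCommGroup E] [NormedSpace ℂ E] {T : ℝ}
    {ψ : ℝ → ℂ} (hψ : Continuous ψ) (hc : HasCompactSupport ψ)
    (u : Lp E 2 (volume.restrict (Ioo 0 T))) :
    Integrable (fun t => ψ t • u t) (volume.restrict (Ioo 0 T)) := by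
  obtain ⟨C, hC⟩ := hψ.bounded_above_of_compact_support hc
  have hu : Integrable u (volume.restrict (Ioo 0 T)) :=
    (Lp.memLp u).integrable (by norm_num)
  exact hu.bdd_smul C hψ.aestronglyMeasurable (Filter.Eventually.of_forall hC)

/-- The Bochner–Sobolev space `H¹((0, T), E)`, as the space of pairs `(u, u')` in
`L²((0, T), E) × L²((0, T), E)` such that `u'` is the weak derivative of `u`, with the norm
`(‖u‖² + ‖u'‖²)^(1/2)`. -/
def H1 (T : ℝ) (E : Type*) [NormedAddCommGroup E] [NormedSpace ℂ E] :
    Submodule ℂ (WithLp 2 (Lp E 2 (volume.restrict (Ioo 0 T)) ×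
      Lp E 2 (volume.restrict (Ioo 0 T)))) where
  carrier := {w | HasWeakDerivOn T w.fst w.snd}
  zero_mem' := by
    intro φ _ _ _
    have h : ∀ ψ : ℝ → ℂ, ∫ t in Ioo 0 T,
        ψ t • (0 : Lp E 2 (volume.restrict (Ioo 0 T))) t = 0 := by
      intro ψ
      rw [integral_eq_zero_of_ae]
      filter_upwards [Lp.coeFn_zero E 2 (volume.restrict (Ioo 0 T))] with t ht
      rw [ht, Pi.zero_apply, smul_zero]
    change ∫ t in Ioo 0 T, deriv φ t • (0 : Lp E 2 (volume.restrict (Ioo 0 T))) t =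
      -∫ t in Ioo 0 T, φ t • (0 : Lp E 2 (volume.restrict (Ioo 0 T))) t
    rw [h, h, neg_zero]
  add_mem' := by
    intro w z hw hz φ h1 h2 h3
    have h : ∀ ψ : ℝ → ℂ, Continuous ψ → HasCompactSupport ψ →
        ∀ u v : Lp E 2 (volume.restrict (Ioo 0 T)),
        ∫ t in Ioo 0 T, ψ t • (u + v) t =
          (∫ t in Ioo 0 T, ψ t • u t) + ∫ t in Ioo 0 T, ψ t • v t := by
      intro ψ hψ hc u v
      rw [← integral_add (integrable_smul_of_test hψ hc u) (integrable_smul_of_test hψ hc v)]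
      apply integral_congr_ae
      filter_upwards [Lp.coeFn_add u v] with t ht
      rw [ht, Pi.add_apply, smul_add]
    have hd : Continuous (deriv φ) := h1.continuous_deriv (by simp)
    change ∫ t in Ioo 0 T, deriv φ t • (w.fst + z.fst) t =
      -∫ t in Ioo 0 T, φ t • (w.snd + z.snd) t
    rw [h _ hd h2.deriv, h _ h1.continuous h2, hw φ h1 h2 h3, hz φ h1 h2 h3, neg_add]
  smul_mem' := by
    intro c w hw φ h1 h2 h3
    have h : ∀ (ψ : ℝ → ℂ) (u : Lp E 2 (volume.restrict (Ioo 0 T))),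
        ∫ t in Ioo 0 T, ψ t • (c • u) t = c • ∫ t in Ioo 0 T, ψ t • u t := by
      intro ψ u
      rw [← integral_smul]
      apply integral_congr_ae
      filter_upwards [Lp.coeFn_smul c u] with t ht
      rw [ht, Pi.smul_apply, smul_comm]
    change ∫ t in Ioo 0 T, deriv φ t • (c • w.fst) t = -∫ t in Ioo 0 T, φ t • (c • w.snd) t
    rw [h, h, hw φ h1 h2 h3, smul_neg]

theorem continuous_integral_smul_of_test {E : Type*} [NormedAddCommGroup E] [NormedSpace ℂ E]
    [CompleteSpace E] {T : ℝ} {ψ : ℝ → ℂ} (hψ : Continuous ψ) (hc : HasCompactSupport ψ) :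
    Continuous fun u : Lp E 2 (volume.restrict (Ioo 0 T)) => ∫ t in Ioo 0 T, ψ t • u t := by
  have hm : MemLp ψ 2 (volume.restrict (Ioo 0 T)) := hψ.memLp_of_hasCompactSupport hc
  refine ((ContinuousLinearMap.lsmul ℂ ℂ (E := E)).lpPairing (volume.restrict (Ioo 0 T)) 2 2
    (hm.toLp ψ)).continuous.congr fun u => ?_
  rw [ContinuousLinearMap.lpPairing_eq_integral]
  apply integral_congr_ae
  filter_upwards [hm.coeFn_toLp] with t h1
  rw [h1, ContinuousLinearMap.lsmul_apply]

instance H1.instCompleteSpace (T : ℝ) (E : Type*) [NormedAddCommGroup E] [NormedSpace ℂ E]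
    [CompleteSpace E] : CompleteSpace (H1 T E) := by
  have hclosed : IsClosed (H1 T E : Set (WithLp 2 (Lp E 2 (volume.restrict (Ioo 0 T)) ×
      Lp E 2 (volume.restrict (Ioo 0 T))))) := by
    have : (H1 T E : Set (WithLp 2 (Lp E 2 (volume.restrict (Ioo 0 T)) ×
      Lp E 2 (volume.restrict (Ioo 0 T))))) = {w | HasWeakDerivOn T w.fst w.snd} := rfl
    rw [this]
    simp only [HasWeakDerivOn, ofPred_forall]
    refine isClosed_iInter fun φ => isClosed_iInter fun h1 => isClosed_iInter fun h2 =>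
      isClosed_iInter fun _ => isClosed_eq ?_ ?_
    · exact (continuous_integral_smul_of_test (h1.continuous_deriv (by simp)) h2.deriv).comp
        (WithLp.prod_continuous_ofLp 2 _ _).fst
    · exact ((continuous_integral_smul_of_test h1.continuous h2).comp
        (WithLp.prod_continuous_ofLp 2 _ _).snd).neg
  exact hclosed.completeSpace_coe

/-- `H¹((0, T), S)`: the elements of `H¹((0, T), E)` whose continuous representative takes its
values in `S` at every point of `(0, T)`. -/
def H1In (T : ℝ) {E : Type*} [NormedAddCommGroup E] [NormedSpace ℂ E] (S : Set E) :
    Set (H1 T E) :=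
  {w | ∃ v : ℝ → E, ContinuousOn v (Ioo 0 T) ∧
    w.1.fst =ᵐ[volume.restrict (Ioo 0 T)] v ∧ ∀ t ∈ Ioo 0 T, v t ∈ S}

end

open MeasureTheory Set
open scoped ENNReal ContDiff Matrix

noncomputable section

open Filter Topology

/-! Expanding the square turns a packet into `P(x) exp(-½ x·Qx + b·x)` with `Q` symmetric, `Re Q`
positive definite and `b` an arbitrary vector of `ℂ^d` (`mem_polyGaussianPackets_iff`). In these
coordinates the parameters `(Q, b)` and the coefficients of `P` range over finite-dimensional
spaces, and Gaussian decay gives membership in `L^r`.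

Density: multiplication by `exp(-‖x - y‖²)` preserves the span of pure Gaussians. The multipliers of
that span form a unital star algebra on the one-point compactification, and Stone–Weierstrass makes
it dense. Approximating `f exp(‖x‖²)` uniformly, for `f` a test function, bounds the error on `f` by
a small multiple of `exp(-‖x‖²)`, hence in `L^r` (`exists_gaussianSpan_approx`).

Weak closedness: follow packets with parameters `(Q, b)` along an ultrafilter converging weakly to
`u₀`, and rescale `(1, (Q, b))` to the unit sphere, with factor `s`. If `s → 0`, the operator `s ∂_j
+ (s Q x - s b)_j` kills the exponential and so lowers the degree of `P` in `x_j`; its power `ν_j +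
1` annihilates the packet. In the limit it becomes multiplication by a power of an affine function,
nontrivial for some `j`, so `u₀ = 0` (`ae_eq_zero_of_tendsto_of_exponent_unbounded`). Otherwise `(Q,
b)` converges, and `u₀` is a polynomial times the limit exponential
(`exists_ae_eq_of_tendsto_of_exponent_tendsto`). The limit of `Re Q` is only positive semidefinite,
but a nonzero `u₀` in `L^r` excludes null directions (`isGaussianForm_of_memLp`).

Sobolev part: `(e, f) ↦ e + ∫₀ᵗ f` identifies `E × L²` with `H¹`, so evaluation at `t` is continuous
and weak closedness passes from `S` to `H1In T S`. For density, the curves `x` and `∫₀ᵗ 1_B x` stay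
on the line `ℂ x`, hence in `S` when `x ∈ S`. -/

/-- The evaluation of a complex polynomial at a real point. -/
def polyEval {d : ℕ} (P : MvPolynomial (Fin d) ℂ) (x : EuclideanSpace ℝ (Fin d)) : ℂ :=
  MvPolynomial.eval (fun j => ((x j : ℝ) : ℂ)) P

/-- The function `x ↦ exp(-(1/2) x · Q x + b · x)`. -/
def quadExp {d : ℕ} (Q : Fin d → Fin d → ℂ) (b : Fin d → ℂ) (x : EuclideanSpace ℝ (Fin d)) : ℂ :=
  Complex.exp (-(1 / 2 : ℂ) * (∑ j, ∑ k, Q j k * x j * x k) + ∑ j, b j * x j)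

/-- `Q` is symmetric with positive definite real part. -/
structure IsGaussianForm {d : ℕ} (Q : Fin d → Fin d → ℂ) : Prop where
  symm : ∀ j k, Q j k = Q k j
  pos : ∀ v : Fin d → ℝ, v ≠ 0 → 0 < ∑ j, ∑ k, (Q j k).re * v j * v k

/-! ### Normal form of the wave packets -/

variable {d : ℕ}

theorem IsGaussianForm.posDef {Q : Fin d → Fin d → ℂ} (hQ : IsGaussianForm Q) :
    (Matrix.of fun j k => (Q j k).re).PosDef := by
  refine Matrix.PosDef.of_dotProduct_mulVec_pos ?_ fun v hv => ?_
  · ext j k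
    simp [hQ.symm j k]
  · refine (hQ.pos v hv).trans_eq ?_
    simp only [dotProduct, Matrix.mulVec, Finset.mul_sum, Matrix.of_apply]
    refine Finset.sum_congr rfl fun j _ => Finset.sum_congr rfl fun k _ => ?_
    simp
    ring

theorem isGaussianForm_of_posDef {A B : Matrix (Fin d) (Fin d) ℝ} (hA : A.PosDef)
    (hB : B.IsSymm) : IsGaussianForm fun j k => (A j k : ℂ) + Complex.I * B j k where
  symm j k := by
    have h1 : A k j = A j k := by simpa using hA.1.apply j k
    rw [h1, hB.apply j k]
  pos v hv := by
    refine (hA.dotProduct_mulVec_pos hv).trans_eq ?_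
    simp only [dotProduct, Matrix.mulVec, Finset.mul_sum]
    refine Finset.sum_congr rfl fun j _ => Finset.sum_congr rfl fun k _ => ?_
    simp
    ring

theorem quadratic_sub_expand {Q : Fin d → Fin d → ℂ} (hQ : ∀ j k, Q j k = Q k j)
    (p q x : Fin d → ℂ) :
    -(1 / 2 : ℂ) * (∑ j, ∑ k, Q j k * (x j - q j) * (x k - q k)) +
        Complex.I * ∑ j, p j * (x j - q j) =
      (-(1 / 2 : ℂ) * (∑ j, ∑ k, Q j k * q j * q k) - Complex.I * ∑ j, p j * q j) +
      (-(1 / 2 : ℂ) * (∑ j, ∑ k, Q j k * x j * x k) +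
        ∑ j, ((∑ k, Q j k * q k) + Complex.I * p j) * x j) := by
  have h1 : ∑ j, ∑ k, Q j k * q j * x k = ∑ j, ∑ k, Q j k * x j * q k := by
    rw [Finset.sum_comm]
    refine Finset.sum_congr rfl fun j _ => Finset.sum_congr rfl fun k _ => ?_
    rw [hQ k j]
    ring
  have h2 : ∑ j, ∑ k, Q j k * (x j - q j) * (x k - q k) =
      ∑ j, ∑ k, Q j k * x j * x k - ∑ j, ∑ k, Q j k * x j * q k
        - ∑ j, ∑ k, Q j k * q j * x k + ∑ j, ∑ k, Q j k * q j * q k := by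
    simp only [← Finset.sum_sub_distrib, ← Finset.sum_add_distrib]
    refine Finset.sum_congr rfl fun j _ => Finset.sum_congr rfl fun k _ => ?_
    ring
  have h3 : ∑ j, ((∑ k, Q j k * q k) + Complex.I * p j) * x j =
      ∑ j, ∑ k, Q j k * x j * q k + Complex.I * ∑ j, p j * x j := by
    rw [Finset.mul_sum, ← Finset.sum_add_distrib]
    refine Finset.sum_congr rfl fun j _ => ?_
    rw [add_mul, Finset.sum_mul]
    congr 1
    · exact Finset.sum_congr rfl fun k _ => by ring
    · ring
  have h4 : ∑ j, p j * (x j - q j) = ∑ j, p j * x j - ∑ j, p j * q j := by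
    simp only [mul_sub, Finset.sum_sub_distrib]
  rw [h2, h1, h3, h4]
  ring

theorem gaussianPacket_eq {A B : Matrix (Fin d) (Fin d) ℝ}
    (hQ : IsGaussianForm fun j k => (A j k : ℂ) + Complex.I * B j k) (a : ℂ)
    (p q x : EuclideanSpace ℝ (Fin d)) :
    gaussianPacket a p q A B x =
      a * Complex.exp (-(1 / 2 : ℂ) *
          (∑ j, ∑ k, ((A j k : ℂ) + Complex.I * B j k) * q j * q k)
            - Complex.I * ∑ j, (p j : ℂ) * q j) *
        quadExp (fun j k => (A j k : ℂ) + Complex.I * B j k)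
          (fun j => (∑ k, ((A j k : ℂ) + Complex.I * B j k) * q k) + Complex.I * p j) x := by
  rw [quadExp, mul_assoc, ← Complex.exp_add,
    ← quadratic_sub_expand hQ.symm (fun j => (p j : ℂ)) (fun j => (q j : ℂ)) fun j => (x j : ℂ),
    Complex.exp_add, ← mul_assoc, gaussianPacket]
  simp only [dotProduct, Matrix.mulVec, Finset.mul_sum, Matrix.add_apply, Matrix.smul_apply,
    Matrix.map_apply, smul_eq_mul, Complex.ofReal_sum, Complex.ofReal_mul, Complex.ofReal_sub]
  congr 3
  refine Finset.sum_congr rfl fun j _ => Finset.sum_congr rfl fun k _ => ?_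
  ring

theorem polyEval_C_mul (c : ℂ) (P : MvPolynomial (Fin d) ℂ) (x : EuclideanSpace ℝ (Fin d)) :
    polyEval (MvPolynomial.C c * P) x = c * polyEval P x := by
  simp [polyEval]

/-- The centre and momentum can be recovered from `b` because `A = Re Q` is invertible: `q` solves
`A q = Re b`, and then `p = Im b - B q`. The constant created by expanding the square is nonzero and
is absorbed in `P` or in `a`. -/
theorem mem_polyGaussianPackets_iff {ν : Fin d → ℕ} {f : EuclideanSpace ℝ (Fin d) → ℂ} :
    f ∈ polyGaussianPackets ν ↔ ∃ (P : MvPolynomial (Fin d) ℂ) (Q : Fin d → Fin d → ℂ)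
      (b : Fin d → ℂ), (∀ j, P.degreeOf j ≤ ν j) ∧ IsGaussianForm Q ∧
        f = fun x => polyEval P x * quadExp Q b x := by
  constructor
  · rintro ⟨P, hP, g, ⟨a, p, q, A, B, hA, hB, rfl⟩, rfl⟩
    have hQ := isGaussianForm_of_posDef hA hB
    obtain ⟨c, b, hc⟩ : ∃ c b, ∀ x, gaussianPacket a p q A B x = c * quadExp _ b x :=
      ⟨_, _, gaussianPacket_eq hQ a p q⟩
    refine ⟨MvPolynomial.C c * P, _, b,
      fun j => (MvPolynomial.degreeOf_C_mul_le P j _).trans (hP j), hQ, funext fun x => ?_⟩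
    rw [polyEval_C_mul, hc, mul_left_comm, mul_assoc]
    rfl
  · rintro ⟨P, Q, b, hP, hQ, rfl⟩
    have hA := hQ.posDef
    set A : Matrix (Fin d) (Fin d) ℝ := Matrix.of fun j k => (Q j k).re with hAdef
    set B : Matrix (Fin d) (Fin d) ℝ := Matrix.of fun j k => (Q j k).im with hBdef
    have hB : B.IsSymm := by
      ext j k
      simp [hBdef, hQ.symm j k]
    have hAB : (fun j k => (A j k : ℂ) + Complex.I * B j k) = Q := by
      funext j k
      simp only [hAdef, hBdef, Matrix.of_apply]
      rw [mul_comm, Complex.re_add_im]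
    obtain ⟨q, hq⟩ : ∃ q : Fin d → ℝ, A *ᵥ q = fun j => (b j).re :=
      ⟨A⁻¹ *ᵥ fun j => (b j).re, by
        rw [Matrix.mulVec_mulVec, Matrix.mul_nonsing_inv _ ((Matrix.isUnit_iff_isUnit_det A).1 hA.isUnit),
          Matrix.one_mulVec]⟩
    let q' : EuclideanSpace ℝ (Fin d) := WithLp.toLp 2 q
    let p : EuclideanSpace ℝ (Fin d) := WithLp.toLp 2 fun j => (b j).im - (B *ᵥ q) j
    have hb : (fun j => (∑ k, ((A j k : ℂ) + Complex.I * B j k) * q' k) + Complex.I * p j) = b := by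
      funext j
      have h1 : ∑ k, (A j k : ℂ) * q k = (b j).re := by
        rw [← congrFun hq j]
        simp [Matrix.mulVec, dotProduct]
      have h2 : ∑ k, (B j k : ℂ) * q k = ((B *ᵥ q) j : ℝ) := by
        simp [Matrix.mulVec, dotProduct]
      simp only [add_mul, Finset.sum_add_distrib, mul_assoc, ← Finset.mul_sum, q', p]
      rw [h1, h2]
      push_cast
      rw [mul_sub, add_add_sub_cancel, mul_comm, Complex.re_add_im]
    have hQ' := hQ
    rw [← hAB] at hQ'
    refine ⟨P, hP, _, ⟨(Complex.exp (-(1 / 2 : ℂ) *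
          (∑ j, ∑ k, ((A j k : ℂ) + Complex.I * B j k) * q' j * q' k)
            - Complex.I * ∑ j, (p j : ℂ) * q' j))⁻¹, p, q', A, B, hA, hB, rfl⟩, funext fun x => ?_⟩
    rw [gaussianPacket_eq hQ', inv_mul_cancel₀ (Complex.exp_ne_zero _), one_mul, hb, hAB]
    rfl

/-! ### Smoothness, Gaussian decay and integrability -/

theorem contDiff_coord (j : Fin d) :
    ContDiff ℝ ∞ fun x : EuclideanSpace ℝ (Fin d) => ((x j : ℝ) : ℂ) :=
  Complex.ofRealCLM.contDiff.comp (EuclideanSpace.proj (𝕜 := ℝ) j).contDiff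

theorem contDiff_polyEval (P : MvPolynomial (Fin d) ℂ) : ContDiff ℝ ∞ (polyEval P) := by
  have : polyEval P = fun x : EuclideanSpace ℝ (Fin d) =>
      ∑ m ∈ P.support, P.coeff m * ∏ j, ((x j : ℝ) : ℂ) ^ m j := by
    funext x
    rw [polyEval, MvPolynomial.eval_eq']
  rw [this]
  exact ContDiff.sum fun m _ => contDiff_const.mul
    (contDiff_prod fun j _ => (contDiff_coord j).pow _)

theorem contDiff_quadExp (Q : Fin d → Fin d → ℂ) (b : Fin d → ℂ) : ContDiff ℝ ∞ (quadExp Q b) := by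
  refine ContDiff.cexp ((contDiff_const.mul (ContDiff.sum fun j _ => ContDiff.sum fun k _ =>
    (contDiff_const.mul (contDiff_coord j)).mul (contDiff_coord k))).add
      (ContDiff.sum fun j _ => contDiff_const.mul (contDiff_coord j)))

theorem quadExp_ne_zero (Q : Fin d → Fin d → ℂ) (b : Fin d → ℂ)
    (x : EuclideanSpace ℝ (Fin d)) : quadExp Q b x ≠ 0 :=
  Complex.exp_ne_zero _

theorem norm_quadExp (Q : Fin d → Fin d → ℂ) (b : Fin d → ℂ) (x : EuclideanSpace ℝ (Fin d)) :
    ‖quadExp Q b x‖ =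
      Real.exp (-(1 / 2) * (∑ j, ∑ k, (Q j k).re * x j * x k) + ∑ j, (b j).re * x j) := by
  rw [quadExp, Complex.norm_exp]
  congr 1
  have h : (-(1 / 2) : ℂ) = ((-(1 / 2) : ℝ) : ℂ) := by push_cast; rfl
  rw [Complex.add_re, h, Complex.re_ofReal_mul, Complex.re_sum, Complex.re_sum]
  simp only [Complex.re_sum, Complex.re_mul_ofReal]

theorem IsGaussianForm.exists_le {Q : Fin d → Fin d → ℂ} (hQ : IsGaussianForm Q) :
    ∃ c > 0, ∀ x : EuclideanSpace ℝ (Fin d),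
      c * ‖x‖ ^ 2 ≤ ∑ j, ∑ k, (Q j k).re * x j * x k := by
  -- The constant is the minimum of the form on the unit sphere; the sphere is empty only in
  -- dimension zero, where any constant works.
  rcases (Metric.sphere (0 : EuclideanSpace ℝ (Fin d)) 1).eq_empty_or_nonempty with he | hne
  · refine ⟨1, one_pos, fun x => ?_⟩
    have hx : x = 0 := by
      by_contra hx
      have : (‖x‖⁻¹ • x) ∈ Metric.sphere (0 : EuclideanSpace ℝ (Fin d)) 1 := by
        rw [mem_sphere_zero_iff_norm, norm_smul, norm_inv, norm_norm,
          inv_mul_cancel₀ (norm_ne_zero_iff.2 hx)]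
      rw [he] at this
      exact this
    simp [hx]
  · obtain ⟨y, hy, hmin⟩ := (isCompact_sphere (0 : EuclideanSpace ℝ (Fin d)) 1).exists_isMinOn hne
      (f := fun x => ∑ j, ∑ k, (Q j k).re * x j * x k) (by fun_prop)
    have hy0 : (fun j => y j) ≠ 0 := by
      intro h
      have : y = 0 := by
        ext j
        exact congrFun h j
      rw [this] at hy
      simp at hy
    refine ⟨_, hQ.pos _ hy0, fun x => ?_⟩
    rcases eq_or_ne x 0 with rfl | hx
    · simp
    have hx' : ‖x‖ ≠ 0 := norm_ne_zero_iff.2 hx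
    have h1 : (‖x‖⁻¹ • x) ∈ Metric.sphere (0 : EuclideanSpace ℝ (Fin d)) 1 := by
      rw [mem_sphere_zero_iff_norm, norm_smul, norm_inv, norm_norm, inv_mul_cancel₀ hx']
    have h2 := isMinOn_iff.1 hmin _ h1
    have h3 : ∑ j, ∑ k, (Q j k).re * (‖x‖⁻¹ • x) j * (‖x‖⁻¹ • x) k =
        (‖x‖⁻¹) ^ 2 * ∑ j, ∑ k, (Q j k).re * x j * x k := by
      simp only [Finset.mul_sum]
      refine Finset.sum_congr rfl fun j _ => Finset.sum_congr rfl fun k _ => ?_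
      simp only [PiLp.smul_apply, smul_eq_mul]
      ring
    rw [h3] at h2
    calc _ ≤ ((‖x‖⁻¹) ^ 2 * ∑ j, ∑ k, (Q j k).re * x j * x k) * ‖x‖ ^ 2 := by gcongr
      _ = _ := by field_simp

/-- An exponential bound is enough against Gaussian decay, and it passes through multiplication by a
coordinate thanks to `t ≤ exp t`. -/
theorem exists_norm_polyEval_le (P : MvPolynomial (Fin d) ℂ) :
    ∃ C k : ℝ, 0 ≤ C ∧ 0 ≤ k ∧ ∀ x, ‖polyEval P x‖ ≤ C * Real.exp (k * ‖x‖) := by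
  induction P using MvPolynomial.induction_on with
  | C a =>
    refine ⟨‖a‖, 0, norm_nonneg _, le_rfl, fun x => ?_⟩
    simp [polyEval]
  | add p q hp hq =>
    obtain ⟨C, k, hC, hk, h⟩ := hp
    obtain ⟨C', k', hC', hk', h'⟩ := hq
    refine ⟨C + C', max k k', by positivity, by positivity, fun x => ?_⟩
    have : polyEval (p + q) x = polyEval p x + polyEval q x := by simp [polyEval]
    rw [this, add_mul]
    refine (norm_add_le _ _).trans (add_le_add ((h x).trans ?_) ((h' x).trans ?_))
    · gcongr
      exact le_max_left _ _
    · gcongr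
      exact le_max_right _ _
  | mul_X p j hp =>
    obtain ⟨C, k, hC, hk, h⟩ := hp
    refine ⟨C, k + 1, hC, by positivity, fun x => ?_⟩
    have : polyEval (p * MvPolynomial.X j) x = polyEval p x * x j := by simp [polyEval]
    rw [this, norm_mul, add_mul, Real.exp_add, ← mul_assoc]
    refine mul_le_mul (h x) ?_ (norm_nonneg _) (by positivity)
    rw [Complex.norm_real, one_mul]
    have h1 := PiLp.norm_apply_le x j
    have h2 := Real.add_one_le_exp ‖x‖
    linarith

theorem exists_norm_polyEval_mul_quadExp_le (P : MvPolynomial (Fin d) ℂ)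
    {Q : Fin d → Fin d → ℂ} (hQ : IsGaussianForm Q) (b : Fin d → ℂ) :
    ∃ C c : ℝ, 0 < c ∧ ∀ x, ‖polyEval P x * quadExp Q b x‖ ≤ C * Real.exp (-c * ‖x‖ ^ 2) := by
  obtain ⟨C, k, hC, hk, hP⟩ := exists_norm_polyEval_le P
  obtain ⟨c, hc, hcQ⟩ := hQ.exists_le
  set β := ∑ j, ‖b j‖ with hβ
  -- Half of the decay `c/2` pays for the linear terms: `(k + β) t ≤ (k + β)² / c + (c / 4) t²`, by
  -- expanding `(k + β - c t / 2)² / c ≥ 0`.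
  refine ⟨C * Real.exp ((k + β) ^ 2 / c), c / 4, by positivity, fun x => ?_⟩
  have hb : ∑ j, (b j).re * x j ≤ β * ‖x‖ := by
    rw [hβ, Finset.sum_mul]
    refine Finset.sum_le_sum fun j _ => ?_
    calc (b j).re * x j ≤ |(b j).re * x j| := le_abs_self _
      _ = |(b j).re| * ‖x j‖ := by rw [abs_mul, Real.norm_eq_abs]
      _ ≤ ‖b j‖ * ‖x‖ := mul_le_mul (Complex.abs_re_le_norm _) (PiLp.norm_apply_le x j)
          (norm_nonneg _) (norm_nonneg _)
  rw [norm_mul, norm_quadExp]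
  calc _ ≤ C * Real.exp (k * ‖x‖) * Real.exp (-(1 / 2) * (c * ‖x‖ ^ 2) + β * ‖x‖) := by
        refine mul_le_mul (hP x) (Real.exp_le_exp.2 ?_) (Real.exp_pos _).le (by positivity)
        linarith [hcQ x]
    _ = C * Real.exp (k * ‖x‖ + (-(1 / 2) * (c * ‖x‖ ^ 2) + β * ‖x‖)) := by
        rw [mul_assoc, ← Real.exp_add]
    _ ≤ C * Real.exp ((k + β) ^ 2 / c + -(c / 4) * ‖x‖ ^ 2) := by
        refine mul_le_mul_of_nonneg_left (Real.exp_le_exp.2 ?_) hC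
        have h0 : 0 ≤ (k + β - c / 2 * ‖x‖) ^ 2 / c := by positivity
        have h1 : (k + β - c / 2 * ‖x‖) ^ 2 / c =
            (k + β) ^ 2 / c - (k + β) * ‖x‖ + c / 4 * ‖x‖ ^ 2 := by
          field_simp
          ring
        linarith
    _ = _ := by rw [Real.exp_add, mul_assoc]

theorem memLp_exp_neg_mul_sq_norm {c : ℝ} (hc : 0 < c) {r : ℝ≥0∞} (hr : r ≠ ⊤) :
    MemLp (fun x : EuclideanSpace ℝ (Fin d) => Real.exp (-c * ‖x‖ ^ 2)) r volume := by
  have hm : Continuous fun x : EuclideanSpace ℝ (Fin d) => Real.exp (-c * ‖x‖ ^ 2) := by fun_prop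
  rcases eq_or_ne r 0 with rfl | hr0
  · exact memLp_zero_iff_aestronglyMeasurable.2 hm.aestronglyMeasurable
  rw [← integrable_norm_rpow_iff hm.aestronglyMeasurable hr0 hr]
  have hcr : 0 < c * r.toReal := mul_pos hc (ENNReal.toReal_pos hr0 hr)
  have h := (GaussianFourier.integrable_cexp_neg_mul_sq_norm_add (b := ((c * r.toReal : ℝ) : ℂ))
    (by simpa using hcr) 0 (0 : EuclideanSpace ℝ (Fin d))).norm
  refine h.congr (Eventually.of_forall fun x => ?_)
  have : -((c * r.toReal : ℝ) : ℂ) * (‖x‖ : ℂ) ^ 2 + 0 * ((inner ℝ (0 : EuclideanSpace ℝ (Fin d)) x : ℝ) : ℂ) =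
      ((-(c * r.toReal) * ‖x‖ ^ 2 : ℝ) : ℂ) := by
    push_cast
    ring
  simp only []
  rw [this, Complex.norm_exp, Complex.ofReal_re, Real.norm_of_nonneg (Real.exp_pos _).le,
    ← Real.exp_mul]
  congr 1
  ring

theorem memLp_polyEval_mul_quadExp (P : MvPolynomial (Fin d) ℂ)
    {Q : Fin d → Fin d → ℂ} (hQ : IsGaussianForm Q) (b : Fin d → ℂ) {r : ℝ≥0∞} (hr : r ≠ ⊤) :
    MemLp (fun x => polyEval P x * quadExp Q b x) r volume := by
  obtain ⟨C, c, hc, h⟩ := exists_norm_polyEval_mul_quadExp_le P hQ b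
  refine (memLp_exp_neg_mul_sq_norm hc hr).of_le_mul (c := C)
    ((contDiff_polyEval P).continuous.mul (contDiff_quadExp Q b).continuous).aestronglyMeasurable
    (Eventually.of_forall fun x => ?_)
  rw [Real.norm_of_nonneg (Real.exp_pos _).le]
  exact h x

theorem memLp_of_mem_polyGaussianPackets {ν : Fin d → ℕ} {r : ℝ≥0∞} (hr : r ≠ ⊤)
    {f : EuclideanSpace ℝ (Fin d) → ℂ} (hf : f ∈ polyGaussianPackets ν) : MemLp f r volume := by
  obtain ⟨P, Q, b, -, hQ, rfl⟩ := mem_polyGaussianPackets_iff.1 hf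
  exact memLp_polyEval_mul_quadExp P hQ b hr

theorem smul_mem_polyGaussianLp {ν : Fin d → ℕ} {r : ℝ≥0∞}
    {u : Lp ℂ r (volume : Measure (EuclideanSpace ℝ (Fin d)))} (hu : u ∈ polyGaussianLp ν r)
    (c : ℂ) : c • u ∈ polyGaussianLp ν r := by
  obtain ⟨f, hf, huf⟩ := hu
  obtain ⟨P, Q, b, hP, hQ, rfl⟩ := mem_polyGaussianPackets_iff.1 hf
  refine ⟨_, mem_polyGaussianPackets_iff.2 ⟨MvPolynomial.C c * P, Q, b,
    fun j => (MvPolynomial.degreeOf_C_mul_le P j _).trans (hP j), hQ, rfl⟩, ?_⟩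
  filter_upwards [huf, Lp.coeFn_smul c u] with x h1 h2
  rw [h2, Pi.smul_apply, h1, polyEval_C_mul, smul_eq_mul, mul_assoc]

/-! ### Density of the span by Stone–Weierstrass -/

theorem quadExp_mul (Q Q' : Fin d → Fin d → ℂ) (b b' : Fin d → ℂ)
    (x : EuclideanSpace ℝ (Fin d)) :
    quadExp Q b x * quadExp Q' b' x = quadExp (Q + Q') (b + b') x := by
  simp only [quadExp, ← Complex.exp_add, Pi.add_apply, add_mul, Finset.sum_add_distrib]
  congr 1
  ring

theorem star_quadExp (Q : Fin d → Fin d → ℂ) (b : Fin d → ℂ) (x : EuclideanSpace ℝ (Fin d)) :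
    star (quadExp Q b x) = quadExp (star Q) (star b) x := by
  simp [quadExp, ← Complex.exp_conj, map_ofNat]

theorem IsGaussianForm.add {Q Q' : Fin d → Fin d → ℂ} (hQ : IsGaussianForm Q)
    (hQ' : IsGaussianForm Q') : IsGaussianForm (Q + Q') where
  symm j k := by simp only [Pi.add_apply, hQ.symm j k, hQ'.symm j k]
  pos v hv := by
    simpa only [Pi.add_apply, Complex.add_re, add_mul, Finset.sum_add_distrib] using
      add_pos (hQ.pos v hv) (hQ'.pos v hv)

theorem IsGaussianForm.star {Q : Fin d → Fin d → ℂ} (hQ : IsGaussianForm Q) :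
    IsGaussianForm (star Q) where
  symm j k := by simp only [Pi.star_apply, hQ.symm j k]
  pos v hv := by simpa using hQ.pos v hv

theorem isGaussianForm_two : IsGaussianForm fun j k : Fin d => if j = k then (2 : ℂ) else 0 where
  symm j k := by simp only [eq_comm]
  pos v hv := by
    obtain ⟨i, hi⟩ := Function.ne_iff.1 hv
    have : ∀ j k : Fin d, (if j = k then (2 : ℂ) else 0).re = if j = k then 2 else 0 := by
      intro j k
      split_ifs <;> simp
    simp only [this, ite_mul, zero_mul, Finset.sum_ite_eq, Finset.mem_univ, if_true]
    refine Finset.sum_pos' (fun j _ => ?_) ⟨i, Finset.mem_univ i, ?_⟩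
    · nlinarith [mul_self_nonneg (v j)]
    · have := mul_self_pos.2 hi
      change 0 < v i * v i at this
      nlinarith

theorem exp_neg_norm_sub_sq (x y : EuclideanSpace ℝ (Fin d)) :
    ((Real.exp (-‖x - y‖ ^ 2) : ℝ) : ℂ) = ((Real.exp (-‖y‖ ^ 2) : ℝ) : ℂ) *
      quadExp (fun j k => if j = k then 2 else 0) (fun j => 2 * (y j : ℂ)) x := by
  rw [quadExp, Complex.ofReal_exp, Complex.ofReal_exp, ← Complex.exp_add]
  congr 1
  rw [EuclideanSpace.norm_sq_eq, EuclideanSpace.norm_sq_eq]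
  simp only [Real.norm_eq_abs, sq_abs, ite_mul, zero_mul, Finset.sum_ite_eq, Finset.mem_univ,
    if_true, PiLp.sub_apply]
  push_cast
  rw [Finset.mul_sum, ← Finset.sum_neg_distrib, ← Finset.sum_neg_distrib,
    ← Finset.sum_add_distrib, ← Finset.sum_add_distrib]
  exact Finset.sum_congr rfl fun j _ => by ring

/-- The space of linear combinations of Gaussian functions. -/
def gaussianSpan (d : ℕ) : Submodule ℂ (EuclideanSpace ℝ (Fin d) → ℂ) :=
  Submodule.span ℂ {f | ∃ Q b, IsGaussianForm Q ∧ f = quadExp Q b}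

theorem quadExp_mem_gaussianSpan {Q : Fin d → Fin d → ℂ} (hQ : IsGaussianForm Q)
    (b : Fin d → ℂ) : quadExp Q b ∈ gaussianSpan d :=
  Submodule.subset_span ⟨Q, b, hQ, rfl⟩

theorem quadExp_mul_mem_gaussianSpan {Q : Fin d → Fin d → ℂ} (hQ : IsGaussianForm Q)
    (b : Fin d → ℂ) {h : EuclideanSpace ℝ (Fin d) → ℂ} (hh : h ∈ gaussianSpan d) :
    (fun x => quadExp Q b x * h x) ∈ gaussianSpan d := by
  refine Submodule.span_induction (p := fun h _ => (fun x => quadExp Q b x * h x) ∈ gaussianSpan d)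
    ?_ ?_ ?_ ?_ hh
  · rintro _ ⟨Q', b', hQ', rfl⟩
    simp only [quadExp_mul]
    exact quadExp_mem_gaussianSpan (hQ.add hQ') _
  · convert (gaussianSpan d).zero_mem using 1
    funext x
    simp
  · intro f g _ _ hf hg
    convert (gaussianSpan d).add_mem hf hg using 1
    funext x
    simp [mul_add]
  · intro c f _ hf
    convert (gaussianSpan d).smul_mem c hf using 1
    funext x
    simp [mul_left_comm]

theorem star_mem_gaussianSpan {h : EuclideanSpace ℝ (Fin d) → ℂ} (hh : h ∈ gaussianSpan d) :
    star h ∈ gaussianSpan d := by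
  refine Submodule.span_induction (p := fun h _ => star h ∈ gaussianSpan d) ?_ ?_ ?_ ?_ hh
  · rintro _ ⟨Q, b, hQ, rfl⟩
    have : star (quadExp Q b) = quadExp (star Q) (star b) := funext fun x => star_quadExp Q b x
    rw [this]
    exact quadExp_mem_gaussianSpan hQ.star _
  · simpa only [star_zero] using (gaussianSpan d).zero_mem
  · intro f g _ _ hf hg
    simpa only [star_add] using (gaussianSpan d).add_mem hf hg
  · intro c f _ hf
    simpa only [star_smul] using (gaussianSpan d).smul_mem _ hf

/-- The continuous functions on the one-point compactification which multiply the span of the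
Gaussian functions into itself. -/
def gaussianMultipliers (d : ℕ) : StarSubalgebra ℂ C(OnePoint (EuclideanSpace ℝ (Fin d)), ℂ) where
  carrier := {F | ∀ h ∈ gaussianSpan d, 
    (fun x : EuclideanSpace ℝ (Fin d) => F (x : OnePoint _) * h x) ∈ gaussianSpan d}
  mul_mem' := by
    intro F G hF hG h hh
    convert hF _ (hG h hh) using 1
    funext x
    simp [mul_assoc]
  add_mem' := by
    intro F G hF hG h hh
    convert (gaussianSpan d).add_mem (hF h hh) (hG h hh) using 1
    funext x
    simp [add_mul]
  algebraMap_mem' := by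
    intro c h hh
    exact (gaussianSpan d).smul_mem c hh
  star_mem' := by
    intro F hF h hh
    convert star_mem_gaussianSpan (hF _ (star_mem_gaussianSpan hh)) using 1
    funext x
    simp [ContinuousMap.star_apply, mul_comm]

/-- The function `x ↦ exp(-‖x - y‖²)` extended by zero to the one-point compactification. -/
def onePointGaussian (y : EuclideanSpace ℝ (Fin d)) :
    C(OnePoint (EuclideanSpace ℝ (Fin d)), ℂ) :=
  OnePoint.continuousMapMk ⟨fun x => ((Real.exp (-‖x - y‖ ^ 2) : ℝ) : ℂ), by fun_prop⟩ 0 (by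
    have h1 : Tendsto (fun x : EuclideanSpace ℝ (Fin d) => ‖x - y‖)
        (cocompact (EuclideanSpace ℝ (Fin d))) atTop :=
      tendsto_norm_cocompact_atTop.comp
        (Homeomorph.subRight y).isClosedEmbedding.tendsto_cocompact
    have h2 : Tendsto (fun x : EuclideanSpace ℝ (Fin d) => Real.exp (-‖x - y‖ ^ 2))
        (cocompact (EuclideanSpace ℝ (Fin d))) (𝓝 0) :=
      Real.tendsto_exp_neg_atTop_nhds_zero.comp ((tendsto_pow_atTop two_ne_zero).comp h1)
    rw [coclosedCompact_eq_cocompact]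
    exact (Complex.continuous_ofReal.tendsto' 0 0 Complex.ofReal_zero).comp h2)

theorem onePointGaussian_coe (y x : EuclideanSpace ℝ (Fin d)) :
    onePointGaussian y (x : OnePoint _) = ((Real.exp (-‖x - y‖ ^ 2) : ℝ) : ℂ) := rfl

theorem onePointGaussian_infty (y : EuclideanSpace ℝ (Fin d)) :
    onePointGaussian y OnePoint.infty = 0 := rfl

theorem onePointGaussian_mem (y : EuclideanSpace ℝ (Fin d)) :
    onePointGaussian y ∈ gaussianMultipliers d := by
  intro h hh
  simp only [onePointGaussian_coe, exp_neg_norm_sub_sq, mul_assoc]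
  exact (gaussianSpan d).smul_mem _ (quadExp_mul_mem_gaussianSpan isGaussianForm_two _ hh)

theorem onePointGaussian_ne (y : EuclideanSpace ℝ (Fin d))
    {z : OnePoint (EuclideanSpace ℝ (Fin d))} (hz : z ≠ y) :
    onePointGaussian y z ≠ onePointGaussian y y := by
  have h1 : onePointGaussian y (y : OnePoint _) = 1 := by simp [onePointGaussian_coe]
  rw [h1]
  induction z using OnePoint.rec with
  | infty => simp [onePointGaussian_infty]
  | coe x =>
    have hx : 0 < ‖x - y‖ := norm_sub_pos_iff.2 fun h => hz (by rw [h])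
    rw [onePointGaussian_coe]
    have : Real.exp (-‖x - y‖ ^ 2) ≠ 1 := by
      rw [Ne, Real.exp_eq_one_iff, neg_eq_zero]
      positivity
    exact_mod_cast this

/-- Of two distinct points at least one is a finite `y`, and the Gaussian centred there takes the
value `1` only at `y`. -/
theorem separatesPoints_gaussianMultipliers :
    (gaussianMultipliers d).SeparatesPoints := by
  intro a b hab
  induction a using OnePoint.rec with
  | coe y => exact ⟨_, ⟨_, onePointGaussian_mem y, rfl⟩, (onePointGaussian_ne y hab.symm).symm⟩
  | infty =>
    induction b using OnePoint.rec with
    | coe y => exact ⟨_, ⟨_, onePointGaussian_mem y, rfl⟩, onePointGaussian_ne y hab⟩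
    | infty => exact absurd rfl hab

/-- A plain uniform bound would not control an `L^r` norm on the whole space. The weight is gained
by approximating `f exp(‖x‖²)` by a multiplier `G` and then multiplying by `exp(-‖x‖²)`, which
returns `G` to the Gaussian span. -/
theorem exists_gaussianSpan_approx {f : EuclideanSpace ℝ (Fin d) → ℂ} (hf : Continuous f)
    (hc : HasCompactSupport f) {ε : ℝ} (hε : 0 < ε) :
    ∃ h ∈ gaussianSpan d, ∀ x, ‖f x - h x‖ ≤ ε * Real.exp (-1 * ‖x‖ ^ 2) := by
  let g : C(EuclideanSpace ℝ (Fin d), ℂ) :=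
    ⟨fun x => f x * ((Real.exp (‖x‖ ^ 2) : ℝ) : ℂ), by fun_prop⟩
  have hg : HasCompactSupport g := hc.mul_right
  let F : C(OnePoint (EuclideanSpace ℝ (Fin d)), ℂ) := OnePoint.continuousMapMk g 0 (by
    rw [coclosedCompact_eq_cocompact]
    exact hg.is_zero_at_infty)
  have hF : F ∈ (gaussianMultipliers d).topologicalClosure := by
    rw [ContinuousMap.starSubalgebra_topologicalClosure_eq_top_of_separatesPoints _
      separatesPoints_gaussianMultipliers]
    trivial
  obtain ⟨G, hG, hFG⟩ := Metric.mem_closure_iff.1 hF ε hε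
  have hγ : (fun x : EuclideanSpace ℝ (Fin d) => ((Real.exp (-1 * ‖x‖ ^ 2) : ℝ) : ℂ)) ∈
      gaussianSpan d := by
    have : (fun x : EuclideanSpace ℝ (Fin d) => ((Real.exp (-1 * ‖x‖ ^ 2) : ℝ) : ℂ)) =
        ((Real.exp (-‖(0 : EuclideanSpace ℝ (Fin d))‖ ^ 2) : ℝ) : ℂ) •
          quadExp (fun j k => if j = k then 2 else 0)
            (fun j => 2 * (((0 : EuclideanSpace ℝ (Fin d)) j : ℝ) : ℂ)) := by
      funext x
      rw [Pi.smul_apply, smul_eq_mul, ← exp_neg_norm_sub_sq, sub_zero, neg_one_mul]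
    rw [this]
    exact (gaussianSpan d).smul_mem _ (quadExp_mem_gaussianSpan isGaussianForm_two _)
  refine ⟨_, hG _ hγ, fun x => ?_⟩
  have h1 : f x = F (x : OnePoint _) * ((Real.exp (-1 * ‖x‖ ^ 2) : ℝ) : ℂ) := by
    change f x = f x * ((Real.exp (‖x‖ ^ 2) : ℝ) : ℂ) * ((Real.exp (-1 * ‖x‖ ^ 2) : ℝ) : ℂ)
    rw [mul_assoc, ← Complex.ofReal_mul, ← Real.exp_add]
    simp
  rw [h1, ← sub_mul, norm_mul, Complex.norm_real, Real.norm_of_nonneg (Real.exp_pos _).le]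
  gcongr
  rw [← dist_eq_norm]
  exact (ContinuousMap.dist_apply_le_dist _).trans hFG.le

theorem exists_mem_span_polyGaussianLp (ν : Fin d → ℕ) {r : ℝ≥0∞} (hr : r ≠ ⊤)
    {h : EuclideanSpace ℝ (Fin d) → ℂ} (hh : h ∈ gaussianSpan d) :
    ∃ w ∈ Submodule.span ℂ (polyGaussianLp ν r), w =ᵐ[volume] h := by
  refine Submodule.span_induction
    (p := fun h _ => ∃ w ∈ Submodule.span ℂ (polyGaussianLp ν r), w =ᵐ[volume] h) ?_ ?_ ?_ ?_ hh
  · rintro _ ⟨Q, b, hQ, rfl⟩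
    have hmem : quadExp Q b ∈ polyGaussianPackets ν :=
      mem_polyGaussianPackets_iff.2 ⟨1, Q, b, fun j => by simp, hQ, by simp [polyEval]⟩
    have hm := memLp_of_mem_polyGaussianPackets hr hmem
    exact ⟨hm.toLp, Submodule.subset_span ⟨_, hmem, hm.coeFn_toLp⟩, hm.coeFn_toLp⟩
  · exact ⟨0, Submodule.zero_mem _, Lp.coeFn_zero _ _ _⟩
  · rintro f g _ _ ⟨v, hv, hvf⟩ ⟨w, hw, hwg⟩
    exact ⟨v + w, Submodule.add_mem _ hv hw, (Lp.coeFn_add v w).trans (hvf.add hwg)⟩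
  · rintro c f _ ⟨v, hv, hvf⟩
    exact ⟨c • v, Submodule.smul_mem _ c hv, (Lp.coeFn_smul c v).trans (hvf.const_smul c)⟩

theorem dense_span_polyGaussianLp (ν : Fin d → ℕ) {r : ℝ≥0∞} [Fact (1 ≤ r)] (hr : r ≠ ⊤) :
    Dense (Submodule.span ℂ (polyGaussianLp ν r) :
      Set (Lp ℂ r (volume : Measure (EuclideanSpace ℝ (Fin d))))) := by
  refine dense_closure.1 ((Lp.dense_hasCompactSupport_contDiff (F := ℂ) (μ := (volume :
    Measure (EuclideanSpace ℝ (Fin d)))) hr).mono ?_)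
  rintro u ⟨f, huf, hc, hf⟩
  refine Metric.mem_closure_iff.2 fun ε hε => ?_
  have hγ := memLp_exp_neg_mul_sq_norm (d := d) one_pos hr
  set N := ‖hγ.toLp‖ with hN
  have hN0 : 0 ≤ N := norm_nonneg _
  obtain ⟨h, hh, hfh⟩ := exists_gaussianSpan_approx hf.continuous hc
    -- Dividing by `N + 1` covers `N = 0` and makes the final inequality strict.
    (ε := ε / (N + 1)) (by positivity)
  obtain ⟨w, hw, hwh⟩ := exists_mem_span_polyGaussianLp ν hr hh
  refine ⟨w, hw, ?_⟩
  rw [dist_eq_norm]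
  have h1 : ‖u - w‖ ≤ ε / (N + 1) * N := by
    rw [hN]
    refine Lp.norm_le_mul_norm_of_ae_le_mul ?_
    filter_upwards [Lp.coeFn_sub u w, huf, hwh, hγ.coeFn_toLp] with x h1 h2 h3 h4
    rw [h1, h4, Pi.sub_apply, h2, h3, Real.norm_of_nonneg (Real.exp_pos _).le]
    exact hfh x
  refine h1.trans_lt ?_
  rw [div_mul_eq_mul_div, div_lt_iff₀ (by positivity)]
  nlinarith

/-! ### Tools for weak limits -/

/-- The weak topology need not be metrizable, so sequences would not suffice. Ultrafilters also
replace every extraction of a subsequence later on. -/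
theorem isClosed_toWeakSpace_image {E : Type*} [NormedAddCommGroup E] [NormedSpace ℂ E] {S : Set E}
    (h : ∀ (G : Ultrafilter E) (x : E), S ∈ G →
      (∀ Λ : E →L[ℂ] ℂ, Tendsto Λ G (𝓝 (Λ x))) → x ∈ S) :
    IsClosed (toWeakSpace ℂ E '' S) := by
  rw [isClosed_iff_ultrafilter]
  intro x G hG hS
  refine ⟨(toWeakSpace ℂ E).symm x, h (G.map (toWeakSpace ℂ E).symm) _ ?_ fun Λ => ?_,
    (toWeakSpace ℂ E).apply_symm_apply x⟩
  · rw [Ultrafilter.mem_map]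
    refine mem_of_superset hS ?_
    rintro _ ⟨y, hy, rfl⟩
    rwa [mem_preimage, LinearEquiv.symm_apply_apply]
  · rw [Ultrafilter.coe_map, tendsto_map'_iff]
    have hc : Continuous fun y : WeakSpace ℂ E => Λ ((toWeakSpace ℂ E).symm y) :=
      WeakBilin.eval_continuous (topDualPairing ℂ E).flip Λ
    exact hc.continuousAt.mono_left hG

/-- Any family of vectors converges along an ultrafilter, up to nonzero scalars whose limit can
vanish only when the limit vector does not. -/
theorem exists_projective_limit {α V : Type*} [NormedAddCommGroup V] [NormedSpace ℂ V]
    [FiniteDimensional ℂ V] (G : Ultrafilter α) (v : α → V) :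
    ∃ (s : α → ℂ) (s₀ : ℂ) (v₀ : V), (∀ a, s a ≠ 0) ∧ Tendsto s G (𝓝 s₀) ∧
      Tendsto (fun a => s a • v a) G (𝓝 v₀) ∧ (s₀ = 0 → v₀ ≠ 0) := by
  -- Dividing `(1, v)` by its sup norm `κ` places it on the unit sphere of `ℂ × V`, which is
  -- compact; a limit on the sphere cannot vanish in both components.
  let κ : α → ℝ := fun a => max 1 ‖v a‖
  have hκ : ∀ a, 0 < κ a := fun a => lt_max_of_lt_left one_pos
  let s : α → ℂ := fun a => ((κ a)⁻¹ : ℝ)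
  have hs : ∀ a, ‖s a‖ = (κ a)⁻¹ := fun a => by
    rw [Complex.norm_real, Real.norm_of_nonneg (inv_pos.2 (hκ a)).le]
  have : ProperSpace (ℂ × V) := FiniteDimensional.proper ℂ _
  have hmem : ∀ a, (s a, s a • v a) ∈ Metric.sphere (0 : ℂ × V) 1 := by
    intro a
    have h1 := mul_max_of_nonneg 1 ‖v a‖ (inv_pos.2 (hκ a)).le
    rw [mul_one] at h1
    rw [mem_sphere_zero_iff_norm, Prod.norm_def, norm_smul, hs, ← h1]
    exact inv_mul_cancel₀ (hκ a).ne'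
  obtain ⟨⟨s₀, v₀⟩, h1, h2⟩ := (isCompact_sphere (0 : ℂ × V) 1).ultrafilter_le_nhds
    (G.map fun a => (s a, s a • v a)) (by
      rw [le_principal_iff, Ultrafilter.coe_map, mem_map]
      exact univ_mem' hmem)
  have h3 : Tendsto (fun a => (s a, s a • v a)) G (𝓝 (s₀, v₀)) := h2
  refine ⟨s, s₀, v₀, fun a => norm_ne_zero_iff.1 (by rw [hs]; exact (inv_pos.2 (hκ a)).ne'),
    (continuous_fst.tendsto _).comp h3, (continuous_snd.tendsto _).comp h3, ?_⟩
  rintro rfl rfl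
  simp at h1

theorem integrable_mul_Lp {r : ℝ≥0∞} [Fact (1 ≤ r)] {φ : EuclideanSpace ℝ (Fin d) → ℂ}
    (hφ : Continuous φ) (hc : HasCompactSupport φ)
    (u : Lp ℂ r (volume : Measure (EuclideanSpace ℝ (Fin d)))) :
    Integrable fun x => φ x * u x :=
  ((Lp.memLp u).locallyIntegrable Fact.out).integrable_smul_left_of_hasCompactSupport hφ hc

theorem exists_clm_integral_mul {r : ℝ≥0∞} [Fact (1 ≤ r)] {φ : EuclideanSpace ℝ (Fin d) → ℂ}
    (hφ : Continuous φ) (hc : HasCompactSupport φ) :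
    ∃ Λ : Lp ℂ r (volume : Measure (EuclideanSpace ℝ (Fin d))) →L[ℂ] ℂ,
      ∀ u, Λ u = ∫ x, φ x * u x := by
  have : ENNReal.HolderConjugate (ENNReal.conjExponent r) r :=
    (ENNReal.HolderConjugate.conjExponent Fact.out).symm
  have hm : MemLp φ (ENNReal.conjExponent r) volume := hφ.memLp_of_hasCompactSupport hc
  have : Fact (1 ≤ ENNReal.conjExponent r) := ⟨ENNReal.HolderConjugate.one_le _ r⟩
  refine ⟨(ContinuousLinearMap.mul ℂ ℂ).lpPairing volume (ENNReal.conjExponent r) r (hm.toLp φ),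
    fun u => ?_⟩
  rw [ContinuousLinearMap.lpPairing_eq_integral]
  refine integral_congr_ae ?_
  filter_upwards [hm.coeFn_toLp] with x hx
  rw [ContinuousLinearMap.mul_apply', hx]

theorem ae_eq_zero_of_forall_test {f : EuclideanSpace ℝ (Fin d) → ℂ}
    (hf : LocallyIntegrable f)
    (h : ∀ φ : EuclideanSpace ℝ (Fin d) → ℂ, ContDiff ℝ ∞ φ → HasCompactSupport φ →
      ∫ x, φ x * f x = 0) : f =ᵐ[volume] 0 := by
  refine ae_eq_zero_of_integral_contDiff_smul_eq_zero hf fun g hg hc => ?_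
  have := h (fun x => (g x : ℂ)) (Complex.ofRealCLM.contDiff.comp hg)
    (hc.comp_left Complex.ofReal_zero)
  simpa only [Complex.real_smul] using this

/-- The zero set is a real affine subspace even though the coefficients are complex. Evaluation at
the origin and at the basis vectors shows that it is proper, hence Lebesgue-null. -/
theorem ae_affine_ne_zero {q : Fin d → ℂ} {β : ℂ} (h : ¬ (q = 0 ∧ β = 0)) :
    ∀ᵐ x : EuclideanSpace ℝ (Fin d), ∑ k, q k * x k - β ≠ 0 := by
  let s : AffineSubspace ℝ (EuclideanSpace ℝ (Fin d)) :=
    { carrier := {x | ∑ k, q k * x k - β = 0}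
      smul_vsub_vadd_mem' := by
        intro c x y z hx hy hz
        simp only [mem_ofPred_eq] at hx hy hz ⊢
        have : ∑ k, q k * ((c • (x -ᵥ y) +ᵥ z) k : ℝ) - β =
            c * (∑ k, q k * x k - β) - c * (∑ k, q k * y k - β) + (∑ k, q k * z k - β) := by
          have h1 : ∑ k, q k * ((c • (x -ᵥ y) +ᵥ z) k : ℝ) =
              c * ∑ k, q k * x k - c * ∑ k, q k * y k + ∑ k, q k * z k := by
            rw [Finset.mul_sum, Finset.mul_sum, ← Finset.sum_sub_distrib, ← Finset.sum_add_distrib]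
            refine Finset.sum_congr rfl fun k _ => ?_
            simp
            ring
          rw [h1]
          ring
        rw [this, hx, hy, hz]
        ring }
  have hs : s ≠ ⊤ := by
    intro hs
    have hall : ∀ x : EuclideanSpace ℝ (Fin d), ∑ k, q k * x k - β = 0 := fun x => by
      have : x ∈ s := by rw [hs]; trivial
      exact this
    have hβ : β = 0 := by simpa using hall 0
    refine h ⟨funext fun j => ?_, hβ⟩
    have := hall (EuclideanSpace.single j 1)
    simpa [hβ, Pi.single_apply, apply_ite Complex.ofReal] using this
  have := Measure.addHaar_affineSubspace (volume : Measure (EuclideanSpace ℝ (Fin d))) s hs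
  rw [ae_iff]
  convert this using 2
  ext x
  exact not_not

/-! ### First-order operators lowering the degree of the polynomial -/

theorem hasFDerivAt_coord (j : Fin d) (x : EuclideanSpace ℝ (Fin d)) :
    HasFDerivAt (fun x : EuclideanSpace ℝ (Fin d) => ((x j : ℝ) : ℂ))
      (Complex.ofRealCLM.comp (EuclideanSpace.proj (𝕜 := ℝ) j)) x :=
  (Complex.ofRealCLM.comp (EuclideanSpace.proj (𝕜 := ℝ) j)).hasFDerivAt

theorem fderiv_quadExp {Q : Fin d → Fin d → ℂ} (hQ : ∀ j k, Q j k = Q k j) (b : Fin d → ℂ)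
    (x : EuclideanSpace ℝ (Fin d)) (j : Fin d) :
    fderiv ℝ (quadExp Q b) x (EuclideanSpace.single j 1) =
      -(∑ k, Q j k * x k - b j) * quadExp Q b x := by
  have h := (((HasFDerivAt.fun_sum (u := Finset.univ) fun i _ =>
    HasFDerivAt.fun_sum (u := Finset.univ) fun k _ =>
      ((hasFDerivAt_coord i x).const_mul (Q i k)).mul (hasFDerivAt_coord k x)).const_mul
        (-(1 / 2 : ℂ))).add (HasFDerivAt.fun_sum (u := Finset.univ) fun i _ =>
          (hasFDerivAt_coord i x).const_mul (b i))).cexp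
  have h' : HasFDerivAt (quadExp Q b) _ x := h
  rw [h'.fderiv]
  have e1 : ∑ i, Q i j * (x i : ℂ) = ∑ i, Q j i * (x i : ℂ) :=
    Finset.sum_congr rfl fun i _ => by rw [hQ]
  have e2 : ∑ k, (x k : ℂ) * Q j k = ∑ k, Q j k * (x k : ℂ) :=
    Finset.sum_congr rfl fun k _ => mul_comm _ _
  simp [Finset.sum_add_distrib, e1, quadExp, apply_ite Complex.ofReal, e2]
  ring

theorem fderiv_polyEval (P : MvPolynomial (Fin d) ℂ) (x : EuclideanSpace ℝ (Fin d)) (j : Fin d) :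
    fderiv ℝ (polyEval P) x (EuclideanSpace.single j 1) =
      polyEval (MvPolynomial.pderiv j P) x := by
  have hd : ∀ P : MvPolynomial (Fin d) ℂ, DifferentiableAt ℝ (polyEval P) x := fun P =>
    (contDiff_polyEval P).differentiable (by simp) x
  induction P using MvPolynomial.induction_on with
  | C a =>
    have : polyEval (MvPolynomial.C a) = fun _ : EuclideanSpace ℝ (Fin d) => a := by
      funext y
      simp [polyEval]
    rw [this]
    simp [polyEval]
  | add p q hp hq =>
    have : polyEval (p + q) = fun y => polyEval p y + polyEval q y := by
      funext y
      simp [polyEval]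
    rw [this, fderiv_fun_add (hd p) (hd q), add_apply, hp, hq]
    simp [polyEval]
  | mul_X p i hp =>
    have : polyEval (p * MvPolynomial.X i) =
        fun y : EuclideanSpace ℝ (Fin d) => polyEval p y * ((y i : ℝ) : ℂ) := by
      funext y
      simp [polyEval]
    have h := (hd p).hasFDerivAt.mul (hasFDerivAt_coord i x)
    rw [this]
    refine (congrArg (fun L : EuclideanSpace ℝ (Fin d) →L[ℝ] ℂ =>
      L (EuclideanSpace.single j 1)) h.fderiv).trans ?_
    simp only [add_apply, smul_apply, hp, smul_eq_mul]
    by_cases hij : i = j <;> simp [polyEval, MvPolynomial.pderiv_X, hij]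

/-- The formal adjoint of `s ∂_j + (s Q x - s b)_j`, where `κ = (s, s Q, s b)`. -/
def adjointOp (κ : ℂ × (Fin d → Fin d → ℂ) × (Fin d → ℂ)) (j : Fin d)
    (φ : EuclideanSpace ℝ (Fin d) → ℂ) (x : EuclideanSpace ℝ (Fin d)) : ℂ :=
  κ.1 * fderiv ℝ φ x (EuclideanSpace.single j 1) - (∑ k, κ.2.1 j k * x k - κ.2.2 j) * φ x

theorem contDiff_partial {φ : EuclideanSpace ℝ (Fin d) → ℂ} (hφ : ContDiff ℝ ∞ φ) (j : Fin d) :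
    ContDiff ℝ ∞ fun x => fderiv ℝ φ x (EuclideanSpace.single j 1) :=
  (hφ.fderiv_right (m := ∞) (by simp)).clm_apply contDiff_const

theorem hasCompactSupport_partial {φ : EuclideanSpace ℝ (Fin d) → ℂ} (hc : HasCompactSupport φ)
    (j : Fin d) : HasCompactSupport fun x => fderiv ℝ φ x (EuclideanSpace.single j 1) :=
  hc.fderiv_apply (𝕜 := ℝ) _

theorem contDiff_affine (q : Fin d → ℂ) (β : ℂ) :
    ContDiff ℝ ∞ fun x : EuclideanSpace ℝ (Fin d) => ∑ k, q k * ((x k : ℝ) : ℂ) - β :=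
  (ContDiff.sum fun k _ => contDiff_const.mul (contDiff_coord k)).sub contDiff_const

theorem contDiff_adjointOp (κ : ℂ × (Fin d → Fin d → ℂ) × (Fin d → ℂ)) (j : Fin d)
    {φ : EuclideanSpace ℝ (Fin d) → ℂ} (hφ : ContDiff ℝ ∞ φ) : ContDiff ℝ ∞ (adjointOp κ j φ) :=
  (contDiff_const.mul (contDiff_partial hφ j)).sub ((contDiff_affine _ _).mul hφ)

theorem hasCompactSupport_adjointOp (κ : ℂ × (Fin d → Fin d → ℂ) × (Fin d → ℂ)) (j : Fin d)
    {φ : EuclideanSpace ℝ (Fin d) → ℂ} (hc : HasCompactSupport φ) :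
    HasCompactSupport (adjointOp κ j φ) :=
  (hasCompactSupport_partial hc j).mul_left.sub hc.mul_left

/-- The operator `s ∂_j + (s Q x - s b)_j` annihilates `quadExp Q b`, so on `P` times this
exponential only `s ∂_j P` survives. Integration by parts moves it to the test function, where, up
to sign, it becomes `adjointOp`. -/
theorem integral_mul_adjointOp (P : MvPolynomial (Fin d) ℂ) {Q : Fin d → Fin d → ℂ}
    (hQ : ∀ j k, Q j k = Q k j) (b : Fin d → ℂ) (s : ℂ) (j : Fin d)
    {φ : EuclideanSpace ℝ (Fin d) → ℂ} (hφ : ContDiff ℝ ∞ φ) (hc : HasCompactSupport φ) :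
    ∫ x, polyEval P x * quadExp Q b x * adjointOp (s, s • (Q, b)) j φ x =
      -s * ∫ x, polyEval (MvPolynomial.pderiv j P) x * quadExp Q b x * φ x := by
  set e := EuclideanSpace.single j (1 : ℝ) with he
  have hP := contDiff_polyEval P
  have hE := contDiff_quadExp Q b
  have hPE : ContDiff ℝ ∞ fun x => polyEval P x * quadExp Q b x := hP.mul hE
  have hd : ∀ x, fderiv ℝ (fun x => polyEval P x * quadExp Q b x) x e =
      polyEval (MvPolynomial.pderiv j P) x * quadExp Q b x -
        (∑ k, Q j k * x k - b j) * (polyEval P x * quadExp Q b x) := by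
    intro x
    have h := ((hP.differentiable (by simp)) x).hasFDerivAt.mul
      ((hE.differentiable (by simp)) x).hasFDerivAt
    refine (congrArg (fun L : EuclideanSpace ℝ (Fin d) →L[ℝ] ℂ => L e) h.fderiv).trans ?_
    simp only [add_apply, smul_apply, smul_eq_mul, he,
      fderiv_polyEval, fderiv_quadExp hQ]
    ring
  have hint : ∀ {f g : EuclideanSpace ℝ (Fin d) → ℂ}, ContDiff ℝ ∞ f → ContDiff ℝ ∞ g →
      HasCompactSupport g → Integrable fun x => f x * g x := fun hf hg hgc =>
    (hf.continuous.mul hg.continuous).integrable_of_hasCompactSupport hgc.mul_left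
  have hparts := integral_mul_fderiv_eq_neg_fderiv_mul_of_integrable (μ := volume) (v := e)
    (hint (contDiff_partial hPE j) hφ hc)
    (hint hPE (contDiff_partial hφ j) (hasCompactSupport_partial hc j)) (hint hPE hφ hc)
    (fun x _ => hPE.differentiable (by simp) x) fun x _ => hφ.differentiable (by simp) x
  have h1 : Integrable fun x => polyEval (MvPolynomial.pderiv j P) x * quadExp Q b x * φ x :=
    hint ((contDiff_polyEval _).mul hE) hφ hc
  have h2 : Integrable fun x : EuclideanSpace ℝ (Fin d) =>
      (∑ k, Q j k * x k - b j) * (polyEval P x * quadExp Q b x) * φ x :=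
    hint ((contDiff_affine _ _).mul hPE) hφ hc
  have h3 : Integrable fun x => polyEval P x * quadExp Q b x * fderiv ℝ φ x e :=
    hint hPE (contDiff_partial hφ j) (hasCompactSupport_partial hc j)
  simp only [hd, sub_mul] at hparts
  rw [integral_sub h1 (by simpa only [sub_mul] using h2)] at hparts
  have h4 : ∀ x, polyEval P x * quadExp Q b x * adjointOp (s, s • (Q, b)) j φ x =
      s * (polyEval P x * quadExp Q b x * fderiv ℝ φ x e) -
        s * ((∑ k, Q j k * x k - b j) * (polyEval P x * quadExp Q b x) * φ x) := by
    intro x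
    simp only [adjointOp, Prod.smul_fst, Prod.smul_snd, Pi.smul_apply, smul_eq_mul, mul_assoc,
      ← Finset.mul_sum]
    ring
  simp only [h4]
  rw [integral_sub (h3.const_mul s) (h2.const_mul s), integral_const_mul, integral_const_mul,
    hparts]
  simp only [sub_mul]
  ring

theorem integral_mul_iterate_adjointOp_eq_zero {Q : Fin d → Fin d → ℂ}
    (hQ : ∀ j k, Q j k = Q k j) (b : Fin d → ℂ) (s : ℂ) (j : Fin d) (n : ℕ) :
    ∀ {P : MvPolynomial (Fin d) ℂ} {φ : EuclideanSpace ℝ (Fin d) → ℂ},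
      (∀ m ∈ P.support, m j < n) → ContDiff ℝ ∞ φ → HasCompactSupport φ →
      ∫ x, polyEval P x * quadExp Q b x * (adjointOp (s, s • (Q, b)) j)^[n] φ x = 0 := by
  induction n with
  | zero =>
    intro P φ hP _ _
    have : P = 0 := by
      rw [← MvPolynomial.support_eq_empty, Finset.eq_empty_iff_forall_notMem]
      exact fun m hm => absurd (hP m hm) (Nat.not_lt_zero _)
    simp [this, polyEval]
  | succ n ih =>
    intro P φ hP hφ hc
    have hn : ContDiff ℝ ∞ ((adjointOp (s, s • (Q, b)) j)^[n] φ) ∧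
        HasCompactSupport ((adjointOp (s, s • (Q, b)) j)^[n] φ) :=
      Function.Iterate.rec (fun ψ : EuclideanSpace ℝ (Fin d) → ℂ =>
        ContDiff ℝ ∞ ψ ∧ HasCompactSupport ψ) ⟨hφ, hc⟩
        (fun ψ h => ⟨contDiff_adjointOp _ j h.1, hasCompactSupport_adjointOp _ j h.2⟩) n
    rw [Function.iterate_succ_apply', integral_mul_adjointOp P hQ b s j hn.1 hn.2, ih _ hφ hc,
      mul_zero]
    -- A monomial `m` of `∂_j P` comes from the monomial of `P` whose exponent in `x_j` is larger by
    -- one.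
    intro m hm
    rw [MvPolynomial.mem_support_iff, MvPolynomial.coeff_pderiv] at hm
    have := hP _ (MvPolynomial.mem_support_iff.2 (left_ne_zero_of_mul hm))
    simpa using this

/-! ### Integrability forces a positive definite real part -/

theorem polyEval_eq_zero_iff {P : MvPolynomial (Fin d) ℂ} :
    (∀ x : EuclideanSpace ℝ (Fin d), polyEval P x = 0) ↔ P = 0 := by
  refine ⟨fun h => ?_, fun h x => by simp [h, polyEval]⟩
  refine MvPolynomial.funext_set (fun _ => range ((↑) : ℝ → ℂ))
    (fun _ => infinite_range_of_injective Complex.ofReal_injective) fun z hz => ?_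
  choose y hy using fun j => hz j (mem_univ j)
  have := h (WithLp.toLp 2 y)
  rw [polyEval] at this
  simp only [hy] at this
  rw [this, map_zero]

/-- The balls of radius `‖v‖ / 2` centred at `y + n v` are disjoint, so the integrals of `|f|^r`
over them have a finite sum. By Tonelli `∑ |f(x + n v)|^r` converges for almost every `x` of the
first ball, and its terms tend to zero. -/
theorem ae_tendsto_translate_zero {f : EuclideanSpace ℝ (Fin d) → ℂ} (hf : Continuous f)
    {r : ℝ≥0∞} (hr0 : r ≠ 0) (hr : r ≠ ⊤) (hfr : MemLp f r volume)
    {v : EuclideanSpace ℝ (Fin d)} (hv : v ≠ 0) (y : EuclideanSpace ℝ (Fin d)) :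
    ∀ᵐ x ∂volume.restrict (Metric.ball y (‖v‖ / 2)),
      Tendsto (fun n : ℕ => f (x + (n : ℝ) • v)) atTop (𝓝 0) := by
  have hr' : 0 < r.toReal := ENNReal.toReal_pos hr0 hr
  let F : EuclideanSpace ℝ (Fin d) → ℝ≥0∞ := fun x => ‖f x‖ₑ ^ r.toReal
  have hF : Continuous F := ENNReal.continuous_rpow_const.comp hf.enorm
  have hFi : ∫⁻ x, F x < ⊤ := (eLpNorm_lt_top_iff_lintegral_rpow_enorm_lt_top hr0 hr).1 hfr.2
  have hFm : ∀ n : ℕ, Measurable fun x => F (x + (n : ℝ) • v) := fun n =>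
    (hF.comp (continuous_add_const _)).measurable
  have hv' : 0 < ‖v‖ := norm_pos_iff.2 hv
  have h1 : ∀ n : ℕ, ∫⁻ x in Metric.ball y (‖v‖ / 2), F (x + (n : ℝ) • v) =
      ∫⁻ x in Metric.ball (y + (n : ℝ) • v) (‖v‖ / 2), F x := by
    intro n
    rw [← (measurePreserving_add_right volume ((n : ℝ) • v)).setLIntegral_comp_preimage_emb
      (measurableEmbedding_addRight _) F (Metric.ball (y + (n : ℝ) • v) (‖v‖ / 2))]
    congr 2
    ext x
    simp [dist_eq_norm]
  have h2 : Pairwise (Function.onFun Disjoint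
      fun n : ℕ => Metric.ball (y + (n : ℝ) • v) (‖v‖ / 2)) := by
    intro m n hmn
    refine Metric.ball_disjoint_ball ?_
    rw [add_halves, dist_eq_norm, add_sub_add_left_eq_sub, ← sub_smul, norm_smul]
    have : (1 : ℝ) ≤ ‖(m : ℝ) - n‖ := by
      have h : (1 : ℤ) ≤ |(m : ℤ) - n| := Int.one_le_abs (sub_ne_zero.2 (by exact_mod_cast hmn))
      rw [Real.norm_eq_abs]
      exact_mod_cast h
    nlinarith
  have h3 : ∫⁻ x in Metric.ball y (‖v‖ / 2), ∑' n : ℕ, F (x + (n : ℝ) • v) ≠ ⊤ := by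
    rw [lintegral_tsum fun n => (hFm n).aemeasurable]
    simp only [h1]
    rw [← lintegral_iUnion (fun n => measurableSet_ball) h2]
    exact ((setLIntegral_le_lintegral _ _).trans_lt hFi).ne
  have hm : AEMeasurable (fun x => ∑' n : ℕ, F (x + (n : ℝ) • v))
      (volume.restrict (Metric.ball y (‖v‖ / 2))) :=
    AEMeasurable.tsum fun n => (hFm n).aemeasurable
  filter_upwards [ae_lt_top' hm h3] with x hx
  have h4 := ENNReal.tendsto_atTop_zero_of_tsum_ne_top hx.ne
  have h5 := ((ENNReal.continuous_rpow_const (y := r.toReal⁻¹)).tendsto 0).comp h4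
  rw [ENNReal.zero_rpow_of_pos (inv_pos.2 hr')] at h5
  refine tendsto_zero_iff_enorm_tendsto_zero.2 (h5.congr fun n => ?_)
  simp only [Function.comp_apply, F]
  rw [← ENNReal.rpow_mul, mul_inv_cancel₀ hr'.ne', ENNReal.rpow_one]

/-- Along a null direction of `Re Q` the term in `t²` disappears, so the logarithm of the modulus is
affine in `t`. -/
theorem norm_quadExp_add_smul {Q : Fin d → Fin d → ℂ} (b : Fin d → ℂ)
    {w : EuclideanSpace ℝ (Fin d)} (hw : ∑ j, ∑ k, (Q j k).re * w j * w k = 0)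
    (x : EuclideanSpace ℝ (Fin d)) (t : ℝ) :
    ‖quadExp Q b (x + t • w)‖ = ‖quadExp Q b x‖ * Real.exp (t *
      (-(1 / 2) * (∑ j, ∑ k, (Q j k).re * (w j * x k + x j * w k)) + ∑ j, (b j).re * w j)) := by
  rw [norm_quadExp, norm_quadExp, ← Real.exp_add]
  congr 1
  have h1 : ∑ j, ∑ k, (Q j k).re * (x + t • w) j * (x + t • w) k =
      ∑ j, ∑ k, (Q j k).re * x j * x k +
        t * ∑ j, ∑ k, (Q j k).re * (w j * x k + x j * w k) +
        t ^ 2 * ∑ j, ∑ k, (Q j k).re * w j * w k := by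
    simp only [Finset.mul_sum, ← Finset.sum_add_distrib]
    refine Finset.sum_congr rfl fun j _ => Finset.sum_congr rfl fun k _ => ?_
    simp
    ring
  have h2 : ∑ j, (b j).re * (x + t • w) j = ∑ j, (b j).re * x j + t * ∑ j, (b j).re * w j := by
    simp only [Finset.mul_sum, ← Finset.sum_add_distrib]
    refine Finset.sum_congr rfl fun j _ => ?_
    simp
    ring
  rw [h1, h2, hw]
  ring

/-- On the line through `x` the polynomial depends on one variable; it is constant or its modulus
tends to infinity, so a zero limit makes it vanish on the line. -/
theorem polyEval_eq_zero_of_tendsto {P : MvPolynomial (Fin d) ℂ}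
    {x w : EuclideanSpace ℝ (Fin d)}
    (h : Tendsto (fun n : ℕ => polyEval P (x + (n : ℝ) • w)) atTop (𝓝 0)) :
    polyEval P x = 0 := by
  let q : Polynomial ℂ := MvPolynomial.aeval
    (fun j => Polynomial.C ((x j : ℝ) : ℂ) + Polynomial.C ((w j : ℝ) : ℂ) * Polynomial.X) P
  have hq : ∀ t : ℝ, q.eval (t : ℂ) = polyEval P (x + t • w) := by
    intro t
    have : (Polynomial.evalRingHom (t : ℂ)).comp (MvPolynomial.aeval (R := ℂ)
        (fun j => Polynomial.C ((x j : ℝ) : ℂ) + Polynomial.C ((w j : ℝ) : ℂ) *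
          Polynomial.X)).toRingHom =
        MvPolynomial.eval fun j => (((x + t • w) j : ℝ) : ℂ) := by
      refine MvPolynomial.ringHom_ext (fun a => ?_) fun j => ?_
      · simp
      · simp only [RingHom.comp_apply, AlgHom.toRingHom_eq_coe, RingHom.coe_coe,
          MvPolynomial.aeval_X, MvPolynomial.eval_X, Polynomial.coe_evalRingHom,
          Polynomial.eval_add, Polynomial.eval_mul, Polynomial.eval_C, Polynomial.eval_X,
          PiLp.add_apply, PiLp.smul_apply, smul_eq_mul, Complex.ofReal_add, Complex.ofReal_mul]
        ring
    exact congrArg (fun g : MvPolynomial (Fin d) ℂ →+* ℂ => g P) this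
  have hq0 : q = 0 := by
    by_contra hne
    rcases lt_or_ge 0 q.degree with hdeg | hdeg
    · have h1 : Tendsto (fun n : ℕ => ‖((n : ℝ) : ℂ)‖) atTop atTop := by
        simpa using tendsto_natCast_atTop_atTop (R := ℝ)
      have h2 := q.tendsto_norm_atTop hdeg h1
      simp only [hq] at h2
      exact not_tendsto_nhds_of_tendsto_atTop h2 _ h.norm
    · have hC := Polynomial.eq_C_of_degree_le_zero hdeg
      have h2 : ∀ n : ℕ, polyEval P (x + (n : ℝ) • w) = q.coeff 0 := fun n => by
        rw [← hq, hC]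
        simp
      simp only [h2] at h
      have h3 := tendsto_nhds_unique h tendsto_const_nhds
      rw [← h3] at hC
      exact hne (by rw [hC, Polynomial.C_0])
  have := hq 0
  rw [hq0, zero_smul, add_zero, Polynomial.eval_zero] at this
  exact this.symm

/-- If `v` were a null direction, then for each `x` the exponential would not decrease along `v` or
along `-v`. Since the product tends to zero along translates in both directions, the polynomial must
do so in one of them, and hence vanishes at `x`. -/
theorem isGaussianForm_of_memLp {P : MvPolynomial (Fin d) ℂ} (hP : P ≠ 0)
    {Q : Fin d → Fin d → ℂ} (hQ : ∀ j k, Q j k = Q k j)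
    (hQ0 : ∀ v : Fin d → ℝ, 0 ≤ ∑ j, ∑ k, (Q j k).re * v j * v k) {b : Fin d → ℂ} {r : ℝ≥0∞}
    (hr0 : r ≠ 0) (hr : r ≠ ⊤) (hf : MemLp (fun x => polyEval P x * quadExp Q b x) r volume) :
    IsGaussianForm Q := by
  refine ⟨hQ, fun v₀ hv₀ => (hQ0 v₀).lt_of_ne fun h0 => hP ?_⟩
  let v : EuclideanSpace ℝ (Fin d) := WithLp.toLp 2 v₀
  have hv : v ≠ 0 := fun h => hv₀ (funext fun j => congrArg (fun x => x.ofLp j) h)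
  have hcont : Continuous fun x => polyEval P x * quadExp Q b x :=
    (contDiff_polyEval P).continuous.mul (contDiff_quadExp Q b).continuous
  -- The exponential growth rate of `‖quadExp Q b‖` along the line `x + t w`; it is odd in `w`.
  let rate : EuclideanSpace ℝ (Fin d) → EuclideanSpace ℝ (Fin d) → ℝ := fun w x =>
    -(1 / 2) * (∑ j, ∑ k, (Q j k).re * (w j * x k + x j * w k)) + ∑ j, (b j).re * w j
  have hneg : ∀ x, rate (-v) x = -rate v x := by
    intro x
    have e1 : ∑ j, ∑ k, (Q j k).re * ((-v) j * x k + x j * (-v) k) =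
        -∑ j, ∑ k, (Q j k).re * (v j * x k + x j * v k) := by
      simp only [← Finset.sum_neg_distrib]
      refine Finset.sum_congr rfl fun j _ => Finset.sum_congr rfl fun k _ => ?_
      simp
      ring
    have e2 : ∑ j, (b j).re * (-v) j = -∑ j, (b j).re * v j := by
      simp [← Finset.sum_neg_distrib]
    simp only [rate, e1, e2]
    ring
  have claim : ∀ w : EuclideanSpace ℝ (Fin d), w ≠ 0 →
      ∑ j, ∑ k, (Q j k).re * w j * w k = 0 → ∀ y,
      ∀ᵐ x ∂volume.restrict (Metric.ball y (‖w‖ / 2)), 0 ≤ rate w x → polyEval P x = 0 := by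
    intro w hw hw0 y
    filter_upwards [ae_tendsto_translate_zero hcont hr0 hr hf hw y] with x hx hrate
    refine polyEval_eq_zero_of_tendsto (w := w) ?_
    have h1 := (hx.norm.div_const ‖quadExp Q b x‖)
    rw [norm_zero, zero_div] at h1
    refine squeeze_zero_norm (fun n => ?_) h1
    have hpos : 0 < ‖quadExp Q b x‖ := norm_pos_iff.2 (quadExp_ne_zero Q b x)
    rw [norm_mul, norm_quadExp_add_smul b hw0, le_div_iff₀ hpos]
    refine mul_le_mul_of_nonneg_left (le_mul_of_one_le_right hpos.le ?_) (norm_nonneg _)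
    exact Real.one_le_exp (mul_nonneg n.cast_nonneg hrate)
  have hneg0 : ∑ j, ∑ k, (Q j k).re * (-v) j * (-v) k = 0 := by
    rw [h0]
    refine Finset.sum_congr rfl fun j _ => Finset.sum_congr rfl fun k _ => ?_
    simp [v]
  refine polyEval_eq_zero_iff.1 fun y => ?_
  have hae : polyEval P =ᵐ[volume.restrict (Metric.ball y (‖v‖ / 2))] fun _ => 0 := by
    have h2 := claim (-v) (neg_ne_zero.2 hv) hneg0 y
    rw [norm_neg] at h2
    filter_upwards [claim v hv h0.symm y, h2] with x hx1 hx2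
    rcases le_total 0 (rate v x) with h | h
    · exact hx1 h
    · exact hx2 (by rw [hneg]; linarith)
  exact Measure.eqOn_open_of_ae_eq hae Metric.isOpen_ball
    (contDiff_polyEval P).continuous.continuousOn continuousOn_const
    (Metric.mem_ball_self (half_pos (norm_pos_iff.2 hv)))

/-! ### Test functions depending on a parameter -/

/-- Finite sums of fixed test functions, with coefficients depending continuously on a parameter. -/
inductive TestFamily {K : Type*} [TopologicalSpace K] :
    (K → EuclideanSpace ℝ (Fin d) → ℂ) → Prop
  | single (c : K → ℂ) (hc : Continuous c) (φ : EuclideanSpace ℝ (Fin d) → ℂ)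
      (hφ : ContDiff ℝ ∞ φ) (hφc : HasCompactSupport φ) : TestFamily fun κ x => c κ * φ x
  | add (Φ Ψ : K → EuclideanSpace ℝ (Fin d) → ℂ) (hΦ : TestFamily Φ) (hΨ : TestFamily Ψ) :
      TestFamily fun κ x => Φ κ x + Ψ κ x

namespace TestFamily

variable {K : Type*} [TopologicalSpace K]

theorem sum {ι : Type*} (t : Finset ι) (Φ : ι → K → EuclideanSpace ℝ (Fin d) → ℂ)
    (h : ∀ i, TestFamily (Φ i)) : TestFamily fun κ x => ∑ i ∈ t, Φ i κ x := by
  classical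
  induction t using Finset.induction_on with
  | empty =>
    simpa using TestFamily.single (K := K) (fun _ => 0) continuous_const
      (fun _ : EuclideanSpace ℝ (Fin d) => 0) contDiff_const HasCompactSupport.zero
  | insert i t hi ih =>
    simp only [Finset.sum_insert hi]
    exact (h i).add _ _ ih

theorem contDiff {Φ : K → EuclideanSpace ℝ (Fin d) → ℂ} (h : TestFamily Φ) (κ : K) :
    ContDiff ℝ ∞ (Φ κ) := by
  induction h with
  | single c hc φ hφ hφc => exact contDiff_const.mul hφ
  | add Φ Ψ _ _ h1 h2 => exact h1.add h2

theorem hasCompactSupport {Φ : K → EuclideanSpace ℝ (Fin d) → ℂ} (h : TestFamily Φ) (κ : K) :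
    HasCompactSupport (Φ κ) := by
  induction h with
  | single c hc φ hφ hφc => exact hφc.mul_left
  | add Φ Ψ _ _ h1 h2 => exact h1.add h2

theorem adjointOp {Φ : ℂ × (Fin d → Fin d → ℂ) × (Fin d → ℂ) → EuclideanSpace ℝ (Fin d) → ℂ}
    (h : TestFamily Φ) (j : Fin d) : TestFamily fun κ => adjointOp κ j (Φ κ) := by
  induction h with
  | single c hc φ hφ hφc =>
    have h1 : TestFamily fun (κ : ℂ × (Fin d → Fin d → ℂ) × (Fin d → ℂ))
        (x : EuclideanSpace ℝ (Fin d)) =>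
          κ.1 * c κ * fderiv ℝ φ x (EuclideanSpace.single j 1) :=
      .single _ (continuous_fst.mul hc) _ (contDiff_partial hφ j) (hasCompactSupport_partial hφc j)
    have h2 : TestFamily fun (κ : ℂ × (Fin d → Fin d → ℂ) × (Fin d → ℂ))
        (x : EuclideanSpace ℝ (Fin d)) => ∑ k, -(κ.2.1 j k) * c κ * ((x k : ℂ) * φ x) :=
      sum _ _ fun k => .single _ (by fun_prop) _ ((contDiff_coord k).mul hφ) hφc.mul_left
    have h3 : TestFamily fun (κ : ℂ × (Fin d → Fin d → ℂ) × (Fin d → ℂ))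
        (x : EuclideanSpace ℝ (Fin d)) => κ.2.2 j * c κ * φ x :=
      .single _ (by fun_prop) _ hφ hφc
    convert (h1.add _ _ h2).add _ _ h3 using 3 with κ x
    have h4 : ∑ k, -(κ.2.1 j k) * c κ * ((x k : ℂ) * φ x) =
        -(∑ k, κ.2.1 j k * x k) * (c κ * φ x) := by
      rw [← Finset.sum_neg_distrib, Finset.sum_mul]
      exact Finset.sum_congr rfl fun k _ => by ring
    have h5 : fderiv ℝ (fun x => c κ * φ x) x (EuclideanSpace.single j 1) =
        c κ * fderiv ℝ φ x (EuclideanSpace.single j 1) := by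
      rw [fderiv_const_mul (hφ.differentiable (by simp) x), smul_apply, smul_eq_mul]
    rw [h4, _root_.adjointOp, h5]
    ring
  | add Φ Ψ hΦ hΨ h1 h2 =>
    convert h1.add _ _ h2 using 3 with κ x
    have h5 : fderiv ℝ (fun x => Φ κ x + Ψ κ x) x (EuclideanSpace.single j 1) =
        fderiv ℝ (Φ κ) x (EuclideanSpace.single j 1) +
          fderiv ℝ (Ψ κ) x (EuclideanSpace.single j 1) := by
      rw [fderiv_fun_add ((hΦ.contDiff κ).differentiable (by simp) x)
        ((hΨ.contDiff κ).differentiable (by simp) x), add_apply]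
    rw [_root_.adjointOp, _root_.adjointOp, _root_.adjointOp, h5]
    ring

theorem iterate_adjointOp {φ : EuclideanSpace ℝ (Fin d) → ℂ} (hφ : ContDiff ℝ ∞ φ)
    (hc : HasCompactSupport φ) (j : Fin d) (n : ℕ) :
    TestFamily fun (κ : ℂ × (Fin d → Fin d → ℂ) × (Fin d → ℂ)) =>
      (_root_.adjointOp κ j)^[n] φ := by
  induction n with
  | zero => simpa using TestFamily.single (fun _ => 1) continuous_const φ hφ hc
  | succ n ih =>
    simp only [Function.iterate_succ_apply']
    exact ih.adjointOp j

/-- Weak convergence only tests against fixed functions, while the operators move with `u`. In a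
`TestFamily` the parameter enters through finitely many scalar coefficients, so the two limits
separate. -/
theorem tendsto_integral {Φ : K → EuclideanSpace ℝ (Fin d) → ℂ} (h : TestFamily Φ) {r : ℝ≥0∞}
    [Fact (1 ≤ r)] {G : Filter (Lp ℂ r (volume : Measure (EuclideanSpace ℝ (Fin d))))}
    {u₀ : Lp ℂ r (volume : Measure (EuclideanSpace ℝ (Fin d)))}
    (hG : ∀ Λ : Lp ℂ r (volume : Measure (EuclideanSpace ℝ (Fin d))) →L[ℂ] ℂ,
      Tendsto Λ G (𝓝 (Λ u₀)))
    {τ : Lp ℂ r (volume : Measure (EuclideanSpace ℝ (Fin d))) → K} {τ₀ : K}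
    (hτ : Tendsto τ G (𝓝 τ₀)) :
    Tendsto (fun u => ∫ x, Φ (τ u) x * u x) G (𝓝 (∫ x, Φ τ₀ x * u₀ x)) := by
  induction h with
  | single c hc φ hφ hφc =>
    obtain ⟨Λ, hΛ⟩ := exists_clm_integral_mul (r := r) hφ.continuous hφc
    simp only [mul_assoc, integral_const_mul, ← hΛ]
    exact ((hc.tendsto τ₀).comp hτ).mul (hG Λ)
  | add Φ Ψ hΦ hΨ h1 h2 =>
    have : ∀ κ (u : Lp ℂ r (volume : Measure (EuclideanSpace ℝ (Fin d)))),
        ∫ x, (Φ κ x + Ψ κ x) * u x = (∫ x, Φ κ x * u x) + ∫ x, Ψ κ x * u x := by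
      intro κ u
      simp only [add_mul]
      exact integral_add (integrable_mul_Lp (hΦ.contDiff κ).continuous (hΦ.hasCompactSupport κ) u)
        (integrable_mul_Lp (hΨ.contDiff κ).continuous (hΨ.hasCompactSupport κ) u)
    simp only [this]
    exact h1.add h2

end TestFamily

/-! ### Weak limits of wave packets -/

theorem iterate_adjointOp_zero (v : (Fin d → Fin d → ℂ) × (Fin d → ℂ)) (j : Fin d)
    (φ : EuclideanSpace ℝ (Fin d) → ℂ) (n : ℕ) (x : EuclideanSpace ℝ (Fin d)) :
    (adjointOp (0, v) j)^[n] φ x = (-(∑ k, v.1 j k * x k - v.2 j)) ^ n * φ x := by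
  induction n with
  | zero => simp
  | succ n ih =>
    rw [Function.iterate_succ_apply', adjointOp, ih]
    ring

/-- The polynomial with prescribed coefficients, of degree at most `ν j` in the variable `j`. -/
def coeffPoly {ν : Fin d → ℕ} (c : (∀ j, Fin (ν j + 1)) → ℂ) : MvPolynomial (Fin d) ℂ :=
  ∑ m, MvPolynomial.monomial (Finsupp.equivFunOnFinite.symm fun j => (m j : ℕ)) (c m)

theorem coeff_coeffPoly {ν : Fin d → ℕ} (c : (∀ j, Fin (ν j + 1)) → ℂ)
    (m : ∀ j, Fin (ν j + 1)) :
    (coeffPoly c).coeff (Finsupp.equivFunOnFinite.symm fun j => (m j : ℕ)) = c m := by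
  rw [coeffPoly, MvPolynomial.coeff_sum, Finset.sum_eq_single m]
  · rw [MvPolynomial.coeff_monomial, if_pos rfl]
  · intro m' _ hm
    rw [MvPolynomial.coeff_monomial, if_neg]
    intro h
    refine hm (funext fun j => Fin.ext ?_)
    exact congrFun (Finsupp.equivFunOnFinite.symm.injective h) j
  · exact fun h => absurd (Finset.mem_univ m) h

theorem degreeOf_coeffPoly_le {ν : Fin d → ℕ} (c : (∀ j, Fin (ν j + 1)) → ℂ) (j : Fin d) :
    (coeffPoly c).degreeOf j ≤ ν j := by
  refine (MvPolynomial.degreeOf_sum_le j _ _).trans (Finset.sup_le fun m _ => ?_)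
  refine MvPolynomial.degreeOf_le_iff.2 fun n hn => ?_
  rw [Finset.mem_singleton.1 (MvPolynomial.support_monomial_subset hn)]
  exact Nat.lt_succ_iff.1 (m j).2

theorem exists_coeffPoly_eq {ν : Fin d → ℕ} {P : MvPolynomial (Fin d) ℂ}
    (hP : ∀ j, P.degreeOf j ≤ ν j) : ∃ c : (∀ j, Fin (ν j + 1)) → ℂ, coeffPoly c = P := by
  refine ⟨fun m => P.coeff (Finsupp.equivFunOnFinite.symm fun j => (m j : ℕ)),
    MvPolynomial.ext _ _ fun n => ?_⟩
  by_cases hn : ∀ j, n j ≤ ν j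
  · have : n = Finsupp.equivFunOnFinite.symm
        fun j => ((⟨n j, Nat.lt_succ_iff.2 (hn j)⟩ : Fin (ν j + 1)) : ℕ) := by
      ext j
      rfl
    rw [this]
    exact coeff_coeffPoly _ fun j => ⟨n j, Nat.lt_succ_iff.2 (hn j)⟩
  · obtain ⟨j, hj⟩ := not_forall.1 hn
    have hz : ∀ R : MvPolynomial (Fin d) ℂ, R.degreeOf j ≤ ν j → R.coeff n = 0 := fun R hR =>
      MvPolynomial.notMem_support_iff.1 fun h => hj (MvPolynomial.degreeOf_le_iff.1 hR n h)
    rw [hz _ (degreeOf_coeffPoly_le _ j), hz _ (hP j)]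

theorem polyEval_coeffPoly {ν : Fin d → ℕ} (c : (∀ j, Fin (ν j + 1)) → ℂ)
    (x : EuclideanSpace ℝ (Fin d)) :
    polyEval (coeffPoly c) x = ∑ m, c m * ∏ j, (x j : ℂ) ^ (m j : ℕ) := by
  simp [polyEval, coeffPoly, MvPolynomial.eval_monomial, Finsupp.prod_fintype]

theorem coeffPoly_eq_zero {ν : Fin d → ℕ} {c : (∀ j, Fin (ν j + 1)) → ℂ}
    (h : coeffPoly c = 0) : c = 0 := by
  funext m
  rw [← coeff_coeffPoly c m, h, MvPolynomial.coeff_zero, Pi.zero_apply]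

theorem continuous_integral_coeffPoly_mul_quadExp {ν : Fin d → ℕ}
    {φ : EuclideanSpace ℝ (Fin d) → ℂ} (hφ : Continuous φ) (hc : HasCompactSupport φ) :
    Continuous fun κ : ((∀ j, Fin (ν j + 1)) → ℂ) × (Fin d → Fin d → ℂ) × (Fin d → ℂ) =>
      ∫ x, φ x * (polyEval (coeffPoly κ.1) x * quadExp κ.2.1 κ.2.2 x) := by
  have h : Continuous fun κ : ((∀ j, Fin (ν j + 1)) → ℂ) × (Fin d → Fin d → ℂ) × (Fin d → ℂ) =>
      ∫ x in tsupport φ, φ x * (polyEval (coeffPoly κ.1) x * quadExp κ.2.1 κ.2.2 x) := by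
    refine continuous_parametric_integral_of_continuous ?_ hc
    simp only [Function.uncurry_def, polyEval_coeffPoly, quadExp]
    fun_prop
  refine h.congr fun κ => setIntegral_eq_integral_of_forall_compl_eq_zero fun x hx => ?_
  rw [image_eq_zero_of_notMem_tsupport hx, zero_mul]

section WeakLimit

variable {ν : Fin d → ℕ} {r : ℝ≥0∞} [Fact (1 ≤ r)]
  {G : Ultrafilter (Lp ℂ r (volume : Measure (EuclideanSpace ℝ (Fin d))))}
  {u₀ : Lp ℂ r (volume : Measure (EuclideanSpace ℝ (Fin d)))}
  {c : Lp ℂ r (volume : Measure (EuclideanSpace ℝ (Fin d))) → (∀ j, Fin (ν j + 1)) → ℂ}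
  {Q : Lp ℂ r (volume : Measure (EuclideanSpace ℝ (Fin d))) → Fin d → Fin d → ℂ}
  {b : Lp ℂ r (volume : Measure (EuclideanSpace ℝ (Fin d))) → Fin d → ℂ}

/-- When `s → 0` the derivative drops out of the annihilating operator, leaving a power of an affine
function times `u₀` equal to zero. No control on the coefficients of the polynomials is needed. -/
theorem ae_eq_zero_of_tendsto_of_exponent_unbounded
    (hG : ∀ Λ : Lp ℂ r (volume : Measure (EuclideanSpace ℝ (Fin d))) →L[ℂ] ℂ,
      Tendsto Λ G (𝓝 (Λ u₀)))
    (hQ : ∀ᶠ u in G, ∀ j k, Q u j k = Q u k j)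
    (hu : ∀ᶠ u : Lp ℂ r (volume : Measure (EuclideanSpace ℝ (Fin d))) in G,
      u =ᵐ[volume] fun x => polyEval (coeffPoly (c u)) x * quadExp (Q u) (b u) x)
    {s : Lp ℂ r (volume : Measure (EuclideanSpace ℝ (Fin d))) → ℂ}
    {v₀ : (Fin d → Fin d → ℂ) × (Fin d → ℂ)} (hs : Tendsto s G (𝓝 0))
    (hv : Tendsto (fun u => s u • (Q u, b u)) G (𝓝 v₀)) (hv₀ : v₀ ≠ 0) : u₀ =ᵐ[volume] 0 := by
  -- Some row of the nonzero limit gives an affine function that is not identically zero.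
  obtain ⟨j, hj⟩ : ∃ j, ¬ (v₀.1 j = 0 ∧ v₀.2 j = 0) := by
    by_contra! h
    exact hv₀ (Prod.ext (funext fun j => (h j).1) (funext fun j => (h j).2))
  have hloc : LocallyIntegrable u₀ volume := (Lp.memLp u₀).locallyIntegrable Fact.out
  have key : (fun x : EuclideanSpace ℝ (Fin d) =>
      (-(∑ k, v₀.1 j k * x k - v₀.2 j)) ^ (ν j + 1) * u₀ x) =ᵐ[volume] 0 := by
    refine ae_eq_zero_of_forall_test
      (hloc.continuous_mul ((contDiff_affine _ _).neg.pow _).continuous) fun φ hφ hc => ?_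
    have hlim := (TestFamily.iterate_adjointOp hφ hc j (ν j + 1)).tendsto_integral hG
      (hs.prodMk_nhds hv)
    -- The degree in `x_j` is at most `ν j`, so `ν j + 1` applications annihilate the packet.
    have hzero : ∀ᶠ u : Lp ℂ r (volume : Measure (EuclideanSpace ℝ (Fin d))) in G,
        ∫ x, (adjointOp (s u, s u • (Q u, b u)) j)^[ν j + 1] φ x * u x = 0 := by
      filter_upwards [hQ, hu] with u hQu hux
      rw [← integral_mul_iterate_adjointOp_eq_zero hQu (b u) (s u) j (ν j + 1)
        (P := coeffPoly (c u)) (fun m hm => Nat.lt_succ_iff.2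
          (MvPolynomial.degreeOf_le_iff.1 (degreeOf_coeffPoly_le (c u) j) m hm)) hφ hc]
      refine integral_congr_ae ?_
      filter_upwards [hux] with x hx
      rw [hx, mul_comm]
    have := tendsto_nhds_unique (hlim.congr' hzero) tendsto_const_nhds
    rw [← this]
    refine integral_congr_ae (Eventually.of_forall fun x => ?_)
    simp only [iterate_adjointOp_zero]
    ring
  filter_upwards [key, ae_affine_ne_zero hj] with x h1 h2
  exact (mul_eq_zero.1 h1).resolve_left (pow_ne_zero _ (neg_ne_zero.2 h2))

/-- The coefficients may be unbounded, so they too are rescaled projectively. Passing to the limit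
against test functions gives `s₀ u₀ = P₀ quadExp Q₀ b₀`. -/
theorem exists_ae_eq_of_tendsto_of_exponent_tendsto
    (hG : ∀ Λ : Lp ℂ r (volume : Measure (EuclideanSpace ℝ (Fin d))) →L[ℂ] ℂ,
      Tendsto Λ G (𝓝 (Λ u₀)))
    (hu : ∀ᶠ u : Lp ℂ r (volume : Measure (EuclideanSpace ℝ (Fin d))) in G,
      u =ᵐ[volume] fun x => polyEval (coeffPoly (c u)) x * quadExp (Q u) (b u) x)
    {Q₀ : Fin d → Fin d → ℂ} {b₀ : Fin d → ℂ} (hQ : Tendsto Q G (𝓝 Q₀))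
    (hb : Tendsto b G (𝓝 b₀)) :
    ∃ c₀ : (∀ j, Fin (ν j + 1)) → ℂ,
      u₀ =ᵐ[volume] fun x => polyEval (coeffPoly c₀) x * quadExp Q₀ b₀ x := by
  obtain ⟨s, s₀, c₀, -, hs, hc, hne⟩ := exists_projective_limit G c
  have hsmul : ∀ (a : ℂ) (e : (∀ j, Fin (ν j + 1)) → ℂ) (x : EuclideanSpace ℝ (Fin d)),
      polyEval (coeffPoly (a • e)) x = a * polyEval (coeffPoly e) x := by
    intro a e x
    simp only [polyEval_coeffPoly, Pi.smul_apply, smul_eq_mul, Finset.mul_sum, mul_assoc]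
  have hcont : Continuous fun x : EuclideanSpace ℝ (Fin d) =>
      polyEval (coeffPoly c₀) x * quadExp Q₀ b₀ x :=
    (contDiff_polyEval _).continuous.mul (contDiff_quadExp _ _).continuous
  have hloc : LocallyIntegrable u₀ volume := (Lp.memLp u₀).locallyIntegrable Fact.out
  have key : (fun x => s₀ * u₀ x - polyEval (coeffPoly c₀) x * quadExp Q₀ b₀ x) =ᵐ[volume] 0 := by
    refine ae_eq_zero_of_forall_test
      ((hloc.smul s₀).sub hcont.locallyIntegrable) fun φ hφ hφc => ?_
    obtain ⟨Λ, hΛ⟩ := exists_clm_integral_mul (r := r) hφ.continuous hφc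
    have h1 : Tendsto (fun u => s u * Λ u) G (𝓝 (s₀ * Λ u₀)) := hs.mul (hG Λ)
    have h2 := ((continuous_integral_coeffPoly_mul_quadExp (ν := ν) hφ.continuous hφc).tendsto
      (c₀, Q₀, b₀)).comp (hc.prodMk_nhds (hQ.prodMk_nhds hb))
    have h3 := tendsto_nhds_unique (h2.congr' ?_) h1
    · have h4 : ∀ x, φ x * (s₀ * u₀ x - polyEval (coeffPoly c₀) x * quadExp Q₀ b₀ x) =
          s₀ * (φ x * u₀ x) - φ x * (polyEval (coeffPoly c₀) x * quadExp Q₀ b₀ x) :=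
        fun x => by ring
      have h5 : Integrable fun x => φ x * (polyEval (coeffPoly c₀) x * quadExp Q₀ b₀ x) :=
        (hφ.continuous.mul hcont).integrable_of_hasCompactSupport hφc.mul_right
      simp only [h4]
      rw [integral_sub ((integrable_mul_Lp hφ.continuous hφc u₀).const_mul s₀) h5,
        integral_const_mul, ← hΛ, h3, sub_self]
    · filter_upwards [hu] with u hux
      simp only [Function.comp_apply, hΛ, hsmul]
      rw [← integral_const_mul]
      refine integral_congr_ae ?_
      filter_upwards [hux] with x hx
      rw [hx]
      ring
  -- If `s₀ = 0`, then `P₀ quadExp Q₀ b₀` vanishes, so `P₀ = 0`, against the nonvanishing of the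
  -- projective limit.
  have hs₀ : s₀ ≠ 0 := by
    intro h0
    refine hne h0 (coeffPoly_eq_zero (polyEval_eq_zero_iff.1 ?_))
    have h1 : (fun x : EuclideanSpace ℝ (Fin d) => polyEval (coeffPoly c₀) x * quadExp Q₀ b₀ x)
        =ᵐ[volume] fun _ => 0 := by
      filter_upwards [key] with x hx
      simpa [h0] using hx
    intro x
    have h2 := congrFun ((hcont.ae_eq_iff_eq volume continuous_const).1 h1) x
    exact (mul_eq_zero.1 h2).resolve_right (quadExp_ne_zero _ _ _)
  refine ⟨s₀⁻¹ • c₀, ?_⟩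
  filter_upwards [key] with x hx
  rw [hsmul, mul_assoc, ← sub_eq_zero.1 hx, inv_mul_cancel_left₀ hs₀]

end WeakLimit

theorem mem_polyGaussianLp_of_ultrafilter {ν : Fin d → ℕ} {r : ℝ≥0∞} [Fact (1 ≤ r)] (hr : r ≠ ⊤)
    (G : Ultrafilter (Lp ℂ r (volume : Measure (EuclideanSpace ℝ (Fin d)))))
    (u₀ : Lp ℂ r (volume : Measure (EuclideanSpace ℝ (Fin d)))) (hS : polyGaussianLp ν r ∈ G)
    (hG : ∀ Λ : Lp ℂ r (volume : Measure (EuclideanSpace ℝ (Fin d))) →L[ℂ] ℂ,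
      Tendsto Λ G (𝓝 (Λ u₀))) : u₀ ∈ polyGaussianLp ν r := by
  -- The zero class is `0` times any packet, and a member of an ultrafilter is nonempty.
  have hzero : u₀ =ᵐ[volume] 0 → u₀ ∈ polyGaussianLp ν r := by
    intro h
    obtain ⟨u, hu⟩ := G.nonempty_of_mem hS
    have h0 : u₀ = (0 : ℂ) • u := by
      rw [zero_smul]
      exact (Lp.eq_zero_iff_ae_eq_zero).2 h
    rw [h0]
    exact smul_mem_polyGaussianLp hu 0
  have hdata : ∀ u : Lp ℂ r (volume : Measure (EuclideanSpace ℝ (Fin d))),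
      ∃ (c : (∀ j, Fin (ν j + 1)) → ℂ) (Q : Fin d → Fin d → ℂ) (b : Fin d → ℂ),
        u ∈ polyGaussianLp ν r → IsGaussianForm Q ∧
          u =ᵐ[volume] fun x => polyEval (coeffPoly c) x * quadExp Q b x := by
    intro u
    by_cases hu : u ∈ polyGaussianLp ν r
    · obtain ⟨f, hf, huf⟩ := hu
      obtain ⟨P, Q, b, hP, hQ, rfl⟩ := mem_polyGaussianPackets_iff.1 hf
      obtain ⟨c, rfl⟩ := exists_coeffPoly_eq hP
      exact ⟨c, Q, b, fun _ => ⟨hQ, huf⟩⟩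
    · exact ⟨0, 0, 0, fun h => absurd h hu⟩
  choose c Q b h using hdata
  have hGS : ∀ᶠ u in G, IsGaussianForm (Q u) := mem_of_superset hS fun u hu => (h u hu).1
  have hux : ∀ᶠ u : Lp ℂ r (volume : Measure (EuclideanSpace ℝ (Fin d))) in G,
      u =ᵐ[volume] fun x => polyEval (coeffPoly (c u)) x * quadExp (Q u) (b u) x :=
    mem_of_superset hS fun u hu => (h u hu).2
  obtain ⟨s, s₀, v₀, hs0, hs, hv, hne⟩ := exists_projective_limit G fun u => (Q u, b u)
  rcases eq_or_ne s₀ 0 with rfl | hs₀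
  · exact hzero (ae_eq_zero_of_tendsto_of_exponent_unbounded hG
      (hGS.mono fun u hu => hu.symm) hux hs hv (hne rfl))
  · have hlim : Tendsto (fun u => (Q u, b u)) G (𝓝 (s₀⁻¹ • v₀)) :=
      ((hs.inv₀ hs₀).smul hv).congr fun u => inv_smul_smul₀ (hs0 u) _
    have hQ₀ : Tendsto Q G (𝓝 (s₀⁻¹ • v₀).1) := (continuous_fst.tendsto _).comp hlim
    have hb₀ : Tendsto b G (𝓝 (s₀⁻¹ • v₀).2) := (continuous_snd.tendsto _).comp hlim
    obtain ⟨c₀, hc₀⟩ := exists_ae_eq_of_tendsto_of_exponent_tendsto hG hux hQ₀ hb₀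
    have hQjk : ∀ j k, Tendsto (fun u => Q u j k) G (𝓝 ((s₀⁻¹ • v₀).1 j k)) := fun j k =>
      tendsto_pi_nhds.1 (tendsto_pi_nhds.1 hQ₀ j) k
    have hsymm : ∀ j k, (s₀⁻¹ • v₀).1 j k = (s₀⁻¹ • v₀).1 k j := fun j k =>
      tendsto_nhds_unique ((hQjk j k).congr' (hGS.mono fun u hu => hu.symm j k)) (hQjk k j)
    have hnonneg : ∀ v : Fin d → ℝ, 0 ≤ ∑ j, ∑ k, ((s₀⁻¹ • v₀).1 j k).re * v j * v k := by
      intro v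
      refine ge_of_tendsto (tendsto_finsetSum _ fun j _ => tendsto_finsetSum _ fun k _ =>
        ((((Complex.continuous_re.tendsto _).comp (hQjk j k)).mul_const (v j)).mul_const (v k)))
        (hGS.mono fun u hu => ?_)
      rcases eq_or_ne v 0 with rfl | hv0
      · simp
      · exact (hu.pos v hv0).le
    -- When the limit polynomial vanishes, the limit of `Re Q` may be degenerate, but then `u₀ = 0`.
    by_cases hP : coeffPoly c₀ = 0
    · refine hzero (hc₀.trans (Eventually.of_forall fun x => ?_))
      simp [hP, polyEval]
    · have hform := isGaussianForm_of_memLp hP hsymm hnonneg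
        (one_pos.trans_le (Fact.out : 1 ≤ r)).ne' hr ((memLp_congr_ae hc₀).1 (Lp.memLp u₀))
      exact ⟨_, mem_polyGaussianPackets_iff.2
        ⟨_, _, _, degreeOf_coeffPoly_le c₀, hform, rfl⟩, hc₀⟩

theorem isDictionary_polyGaussianLp (ν : Fin d → ℕ) {r : ℝ≥0∞} [Fact (1 ≤ r)] (hr : r ≠ ⊤) :
    IsDictionary (polyGaussianLp ν r) where
  smul_mem _ hu c := smul_mem_polyGaussianLp hu c
  weakly_closed := isClosed_toWeakSpace_image (mem_polyGaussianLp_of_ultrafilter hr)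
  dense_span := dense_span_polyGaussianLp ν hr

/-! ### Primitives and weak derivatives on an interval -/

theorem integrableOn_Ioc_of_lt {E : Type*} [NormedAddCommGroup E] {T : ℝ} {f : ℝ → E}
    (hf : Integrable f (volume.restrict (Ioo 0 T))) {t : ℝ} (ht : t < T) :
    IntegrableOn f (Ioc 0 t) :=
  IntegrableOn.mono_set (s := Ioc 0 t) (t := Ioo 0 T) hf (Ioc_subset_Ioo_right ht)

section Primitive

variable {E : Type*} [NormedAddCommGroup E] [NormedSpace ℂ E] {T : ℝ}

theorem continuousOn_primitive_Ioo {f : ℝ → E} (hf : Integrable f (volume.restrict (Ioo 0 T))) :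
    ContinuousOn (fun t => ∫ s in Ioc 0 t, f s) (Ioo 0 T) := by
  have h : IntegrableOn f (Icc 0 T) := (integrableOn_Icc_iff_integrableOn_Ioo (by simp) (by simp)).2 hf
  exact (intervalIntegral.continuousOn_primitive h).mono Ioo_subset_Icc_self

theorem norm_primitive_le {f : ℝ → E} (hf : Integrable f (volume.restrict (Ioo 0 T))) {t : ℝ}
    (ht : t ∈ Ioo 0 T) : ‖∫ s in Ioc 0 t, f s‖ ≤ ∫ s in Ioo 0 T, ‖f s‖ :=
  (norm_integral_le_integral_norm _).trans
    (setIntegral_mono_set hf.norm (Eventually.of_forall fun _ => norm_nonneg _)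
      (Ioc_subset_Ioo_right ht.2).eventuallyLE)

theorem primitive_congr_ae {f g : ℝ → E} (h : f =ᵐ[volume.restrict (Ioo 0 T)] g) {t : ℝ}
    (ht : t < T) : ∫ s in Ioc 0 t, f s = ∫ s in Ioc 0 t, g s :=
  integral_congr_ae (ae_restrict_of_ae_restrict_of_subset (Ioc_subset_Ioo_right ht) h)

/-- Fubini on the triangle `s ≤ t` of the square `(0, T)²`. -/
theorem integral_smul_primitive [CompleteSpace E] {ψ : ℝ → ℂ} (hψ : Continuous ψ) {f : ℝ → E}
    (hf : Integrable f (volume.restrict (Ioo 0 T))) :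
    ∫ t in Ioo 0 T, ψ t • ∫ s in Ioc 0 t, f s = ∫ s in Ioo 0 T, (∫ t in Ico s T, ψ t) • f s := by
  have hψi : Integrable ψ (volume.restrict (Ioo 0 T)) :=
    (hψ.integrableOn_Icc (a := 0) (b := T)).mono_set Ioo_subset_Icc_self
  have hm : MeasurableSet {z : ℝ × ℝ | z.2 ≤ z.1} := measurableSet_le measurable_snd measurable_fst
  have hint : Integrable (Function.uncurry fun t s => {z : ℝ × ℝ | z.2 ≤ z.1}.indicator
      (fun z => ψ z.1 • f z.2) (t, s))
      ((volume.restrict (Ioo 0 T)).prod (volume.restrict (Ioo 0 T))) :=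
    (hψi.smul_prod hf).indicator hm
  have h := integral_integral_swap hint
  have h1 : ∀ t ∈ Ioo 0 T, ∫ s in Ioo 0 T, {z : ℝ × ℝ | z.2 ≤ z.1}.indicator
      (fun z => ψ z.1 • f z.2) (t, s) = ψ t • ∫ s in Ioc 0 t, f s := by
    intro t ht
    have e : ∀ s, {z : ℝ × ℝ | z.2 ≤ z.1}.indicator (fun z => ψ z.1 • f z.2) (t, s) =
        (Iic t).indicator (fun s => ψ t • f s) s := fun s => by simp [indicator]
    have e2 : Ioo 0 T ∩ Iic t = Ioc 0 t := by
      ext s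
      simp only [mem_inter_iff, mem_Ioo, mem_Iic, mem_Ioc]
      exact ⟨fun h => ⟨h.1.1, h.2⟩, fun h => ⟨⟨h.1, h.2.trans_lt ht.2⟩, h.2⟩⟩
    simp only [e]
    rw [setIntegral_indicator measurableSet_Iic, e2, integral_smul]
  have h2 : ∀ s ∈ Ioo 0 T, ∫ t in Ioo 0 T, {z : ℝ × ℝ | z.2 ≤ z.1}.indicator
      (fun z => ψ z.1 • f z.2) (t, s) = (∫ t in Ico s T, ψ t) • f s := by
    intro s hs
    have e : ∀ t, {z : ℝ × ℝ | z.2 ≤ z.1}.indicator (fun z => ψ z.1 • f z.2) (t, s) =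
        (Ici s).indicator (fun t => ψ t • f s) t := fun s => by simp [indicator]
    have e2 : Ioo 0 T ∩ Ici s = Ico s T := by
      ext t
      simp only [mem_inter_iff, mem_Ioo, mem_Ici, mem_Ico]
      exact ⟨fun h => ⟨h.2, h.1.2⟩, fun h => ⟨⟨hs.1.trans_le h.1, h.2⟩, h.1⟩⟩
    simp only [e]
    rw [setIntegral_indicator measurableSet_Ici, e2, integral_smul_const]
  rw [← setIntegral_congr_fun measurableSet_Ioo h1, h,
    setIntegral_congr_fun measurableSet_Ioo h2]

theorem eq_zero_of_tsupport_subset {φ : ℝ → ℂ} (h : tsupport φ ⊆ Ioo 0 T) {t : ℝ}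
    (ht : t ∉ Ioo 0 T) : φ t = 0 :=
  image_eq_zero_of_notMem_tsupport fun h' => ht (h h')

theorem integral_Ico_deriv_of_test {φ : ℝ → ℂ} (hφ : ContDiff ℝ ∞ φ)
    (h : tsupport φ ⊆ Ioo 0 T) {s : ℝ} (hs : s ≤ T) : ∫ t in Ico s T, deriv φ t = -φ s := by
  rw [integral_Ico_eq_integral_Ioc, ← intervalIntegral.integral_of_le hs,
    intervalIntegral.integral_deriv_of_contDiffOn_Icc (hφ.of_le (by simp)).contDiffOn hs,
    eq_zero_of_tsupport_subset h (by simp), zero_sub]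

theorem integral_Ioo_deriv_of_test {φ : ℝ → ℂ} (hφ : ContDiff ℝ ∞ φ)
    (h : tsupport φ ⊆ Ioo 0 T) (hT : 0 < T) : ∫ t in Ioo 0 T, deriv φ t = 0 := by
  rw [← integral_Ico_eq_integral_Ioo, integral_Ico_deriv_of_test hφ h hT.le,
    eq_zero_of_tsupport_subset h (by simp), neg_zero]

theorem integrable_test_smul {ψ : ℝ → ℂ} (hψ : Continuous ψ) (hc : HasCompactSupport ψ)
    {f : ℝ → E} (hf : Integrable f (volume.restrict (Ioo 0 T))) :
    Integrable (fun t => ψ t • f t) (volume.restrict (Ioo 0 T)) := by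
  obtain ⟨C, hC⟩ := hψ.bounded_above_of_compact_support hc
  exact hf.bdd_smul C hψ.aestronglyMeasurable (Eventually.of_forall hC)

theorem integrable_primitive {f : ℝ → E} (hf : Integrable f (volume.restrict (Ioo 0 T))) :
    Integrable (fun t => ∫ s in Ioc 0 t, f s) (volume.restrict (Ioo 0 T)) :=
  Integrable.of_bound ((continuousOn_primitive_Ioo hf).aestronglyMeasurable measurableSet_Ioo)
    (∫ s in Ioo 0 T, ‖f s‖)
    ((ae_restrict_iff' measurableSet_Ioo).2 (Eventually.of_forall fun _ ht =>
      norm_primitive_le hf ht))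

theorem hasWeakDerivOn_primitive [CompleteSpace E] (hT : 0 < T) (e : E) {f : ℝ → E}
    (hf : Integrable f (volume.restrict (Ioo 0 T))) :
    HasWeakDerivOn T (fun t => e + ∫ s in Ioc 0 t, f s) f := by
  intro φ hφ hc hsupp
  have hd : Continuous (deriv φ) := hφ.continuous_deriv (by simp)
  have hdi : Integrable (deriv φ) (volume.restrict (Ioo 0 T)) :=
    (hd.integrable_of_hasCompactSupport hc.deriv).restrict
  simp only [smul_add]
  rw [integral_add (hdi.smul_const e) (integrable_test_smul hd hc.deriv (integrable_primitive hf)),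
    integral_smul_const, integral_Ioo_deriv_of_test hφ hsupp hT, zero_smul, zero_add,
    integral_smul_primitive hd hf, ← integral_neg]
  refine setIntegral_congr_fun measurableSet_Ioo fun s hs => ?_
  simp only [integral_Ico_deriv_of_test hφ hsupp hs.2.le, neg_smul]

/-- A compactly supported smooth function with vanishing integral is the derivative of a compactly
supported smooth function. -/
theorem exists_test_deriv_eq {h : ℝ → ℝ} (hh : ContDiff ℝ ∞ h) (hc : HasCompactSupport h)
    (hsupp : tsupport h ⊆ Ioo 0 T) (h0 : ∫ t, h t = 0) :
    ∃ φ : ℝ → ℂ, ContDiff ℝ ∞ φ ∧ HasCompactSupport φ ∧ tsupport φ ⊆ Ioo 0 T ∧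
      ∀ t, deriv φ t = h t := by
  rcases (tsupport h).eq_empty_or_nonempty with he | hne
  · refine ⟨0, contDiff_const, HasCompactSupport.zero, by simp, fun t => ?_⟩
    have : h = 0 := tsupport_eq_empty_iff.1 he
    simp [this]
  have hcomp : IsCompact (tsupport h) := hc
  obtain ⟨a, ha, hamin⟩ := hcomp.exists_isLeast hne
  obtain ⟨b, hb, hbmax⟩ := hcomp.exists_isGreatest hne
  have ha' := hsupp ha
  have hb' := hsupp hb
  have hz : ∀ s, s ∉ Icc a b → h s = 0 := fun s hs =>
    image_eq_zero_of_notMem_tsupport fun hs' => hs ⟨hamin hs', hbmax hs'⟩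
  let K : ℝ → ℝ := fun t => ∫ s in (0 : ℝ)..t, h s
  have hK : ∀ t, HasDerivAt K (h t) t := fun t =>
    intervalIntegral.integral_hasDerivAt_right (hh.continuous.intervalIntegrable _ _)
      (hh.continuous.stronglyMeasurableAtFilter _ _) hh.continuous.continuousAt
  have hKs : ContDiff ℝ ∞ K := by
    have hd : deriv K = h := funext fun t => (hK t).deriv
    rw [contDiff_infty_iff_deriv, hd]
    exact ⟨fun t => (hK t).differentiableAt, hh⟩
  -- To the left of `a` the interval of integration misses the support of `h`; to the right of `b`
  -- the integral is the total one, which is zero.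
  have hKz : ∀ t, t ∉ Icc a b → K t = 0 := by
    intro t ht
    rcases lt_or_ge t a with hta | hta
    · refine intervalIntegral.integral_zero_ae (Eventually.of_forall fun s hs => hz s fun hs' => ?_)
      have h1 : s ≤ max 0 t := hs.2
      exact absurd (hs'.1.trans h1) (not_le.2 (max_lt ha'.1 hta))
    · have htb : b < t := not_le.1 fun h => ht ⟨hta, h⟩
      refine (intervalIntegral.integral_eq_integral_of_support_subset fun s hs => ?_).trans h0
      have hs' : s ∈ Icc a b := by_contra fun h' => hs (hz s h')
      exact ⟨ha'.1.trans_le hs'.1, hs'.2.trans htb.le⟩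
  have hsub : tsupport (fun t => (K t : ℂ)) ⊆ Icc a b := by
    refine closure_minimal (fun t ht => by_contra fun h' => ht ?_) isClosed_Icc
    simp [hKz t h']
  refine ⟨fun t => (K t : ℂ), Complex.ofRealCLM.contDiff.comp hKs,
    isCompact_Icc.of_isClosed_subset (isClosed_tsupport _) hsub,
    hsub.trans fun t ht => ⟨ha'.1.trans_le ht.1, ht.2.trans_lt hb'.2⟩,
    fun t => (hK t).ofReal_comp.deriv⟩

/-- A function with vanishing weak derivative is constant. -/
theorem ae_eq_const_of_weakDeriv_eq_zero [CompleteSpace E] (hT : 0 < T) {z : ℝ → E}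
    (hz : Integrable z (volume.restrict (Ioo 0 T))) (hw : HasWeakDerivOn T z fun _ => 0) :
    ∃ e : E, z =ᵐ[volume.restrict (Ioo 0 T)] fun _ => e := by
  -- A unit-mass bump supported in `[T/4, 3T/4]`; the constant sought is the mean of `z` against it.
  let β : ContDiffBump (T / 2) := ⟨T / 8, T / 4, by positivity, by linarith⟩
  let ρ : ℝ → ℝ := β.normed volume
  have hρ : ContDiff ℝ ∞ ρ := β.contDiff_normed
  have hρc : HasCompactSupport ρ := β.hasCompactSupport_normed
  have hρs : tsupport ρ ⊆ Ioo 0 T := by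
    rw [β.tsupport_normed_eq, Real.closedBall_eq_Icc]
    intro t ht
    have h1 : T / 2 - T / 4 ≤ t := ht.1
    have h2 : t ≤ T / 2 + T / 4 := ht.2
    exact ⟨by linarith, by linarith⟩
  have hρ1 : ∫ t, ρ t = 1 := β.integral_normed
  have hint : ∀ {g : ℝ → ℝ}, Continuous g → HasCompactSupport g →
      Integrable (fun t => g t • z t) (volume.restrict (Ioo 0 T)) := by
    intro g hg hgc
    simpa only [Complex.coe_smul] using integrable_test_smul
      (ψ := fun t => (g t : ℂ)) (Complex.continuous_ofReal.comp hg) (hgc.comp_left Complex.ofReal_zero) hz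
  set e := ∫ t in Ioo 0 T, ρ t • z t with he
  refine ⟨e, ?_⟩
  have key : ∀ᵐ t, t ∈ Ioo 0 T → z t - e = 0 := by
    refine isOpen_Ioo.ae_eq_zero_of_integral_contDiff_smul_eq_zero
      (IntegrableOn.locallyIntegrableOn (hz.sub (integrable_const e))) fun g hg hgc hgs => ?_
    -- Subtracting `m ρ` from `g` leaves mean zero, hence the derivative of a test function, to
    -- which the hypothesis on `z` applies.
    set m := ∫ t, g t with hm
    have hgi : Integrable g := hg.continuous.integrable_of_hasCompactSupport hgc
    have hρi : Integrable ρ := hρ.continuous.integrable_of_hasCompactSupport hρc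
    have hsupp : tsupport (fun t => g t - m * ρ t) ⊆ Ioo 0 T :=
      (tsupport_sub g fun t => m * ρ t).trans
        (union_subset hgs ((tsupport_mul_subset_right (f := fun _ => m)).trans hρs))
    obtain ⟨φ, h1, h2, h3, h4⟩ := exists_test_deriv_eq (h := fun t => g t - m * ρ t)
      (hg.sub (contDiff_const.mul hρ)) (hgc.sub hρc.mul_left) hsupp (by
        rw [integral_sub hgi (hρi.const_mul m), integral_const_mul, hρ1, mul_one, ← hm, sub_self])
    have h5 := hw φ h1 h2 h3
    simp only [h4, smul_zero, integral_zero, neg_zero, Complex.coe_smul, sub_smul, mul_smul] at h5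
    have h7 : Integrable (fun t => m • ρ t • z t) (volume.restrict (Ioo 0 T)) :=
      (hint hρ.continuous hρc).smul m
    rw [integral_sub (hint hg.continuous hgc) h7, integral_smul, ← he] at h5
    rw [← setIntegral_eq_integral_of_forall_compl_eq_zero (s := Ioo 0 T) (fun t ht => by
      rw [image_eq_zero_of_notMem_tsupport fun h' => ht (hgs h'), zero_smul])]
    have h6 : ∫ t in Ioo 0 T, g t = m :=
      setIntegral_eq_integral_of_forall_compl_eq_zero fun t ht =>
        image_eq_zero_of_notMem_tsupport fun h' => ht (hgs h')
    simp only [smul_sub]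
    rw [integral_sub (hint hg.continuous hgc) (hgi.restrict.smul_const e), integral_smul_const, h6]
    exact h5
  rw [EventuallyEq, ae_restrict_iff' measurableSet_Ioo]
  exact key.mono fun t ht htI => sub_eq_zero.1 (ht htI)

end Primitive

/-! ### The space `H¹((0, T), E)` and its dictionaries -/

theorem integrable_of_Lp_two {E : Type*} [NormedAddCommGroup E] {T : ℝ}
    (f : Lp E 2 (volume.restrict (Ioo 0 T))) : Integrable f (volume.restrict (Ioo 0 T)) :=
  (Lp.memLp f).integrable (by norm_num)

section Sobolev

variable {E : Type*} [NormedAddCommGroup E] [NormedSpace ℂ E] {T : ℝ}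

theorem exists_integral_norm_le (T : ℝ) (E : Type*) [NormedAddCommGroup E] :
    ∃ C : ℝ, 0 ≤ C ∧ ∀ f : Lp E 2 (volume.restrict (Ioo 0 T)), ∫ t in Ioo 0 T, ‖f t‖ ≤ C * ‖f‖ := by
  let μ : Measure ℝ := volume.restrict (Ioo 0 T)
  let C : ℝ≥0∞ := μ univ ^ (1 / (1 : ℝ≥0∞).toReal - 1 / (2 : ℝ≥0∞).toReal)
  have hC : C ≠ ⊤ := ENNReal.rpow_ne_top_of_nonneg (by norm_num) (measure_ne_top μ _)
  refine ⟨C.toReal, ENNReal.toReal_nonneg, fun f => ?_⟩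
  have h := eLpNorm_le_eLpNorm_mul_rpow_measure_univ (p := 1) (q := 2) (by norm_num)
    (Lp.aestronglyMeasurable f)
  rw [integral_norm_eq_lintegral_enorm (Lp.aestronglyMeasurable f), ← eLpNorm_one_eq_lintegral_enorm,
    Lp.norm_def, mul_comm, ← ENNReal.toReal_mul]
  exact ENNReal.toReal_mono (ENNReal.mul_ne_top (Lp.eLpNorm_ne_top f) hC) h

theorem memLp_primitive (f : Lp E 2 (volume.restrict (Ioo 0 T))) :
    MemLp (fun t => ∫ s in Ioc 0 t, f s) 2 (volume.restrict (Ioo 0 T)) :=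
  MemLp.of_bound ((continuousOn_primitive_Ioo (integrable_of_Lp_two f)).aestronglyMeasurable
      measurableSet_Ioo) (∫ s in Ioo 0 T, ‖f s‖)
    ((ae_restrict_iff' measurableSet_Ioo).2 (Eventually.of_forall fun _ ht =>
      norm_primitive_le (integrable_of_Lp_two f) ht))

theorem primitive_add (f g : Lp E 2 (volume.restrict (Ioo 0 T))) {t : ℝ} (ht : t < T) :
    ∫ s in Ioc 0 t, (f + g) s = (∫ s in Ioc 0 t, f s) + ∫ s in Ioc 0 t, g s := by
  rw [primitive_congr_ae (Lp.coeFn_add f g) ht]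
  exact integral_add (integrableOn_Ioc_of_lt (integrable_of_Lp_two f) ht)
    (integrableOn_Ioc_of_lt (integrable_of_Lp_two g) ht)

theorem primitive_smul (c : ℂ) (f : Lp E 2 (volume.restrict (Ioo 0 T))) {t : ℝ} (ht : t < T) :
    ∫ s in Ioc 0 t, (c • f) s = c • ∫ s in Ioc 0 t, f s := by
  rw [primitive_congr_ae (Lp.coeFn_smul c f) ht]
  exact integral_smul c _

/-- The primitive vanishing at `0`, as an operator on `L²((0, T), E)`. -/
def primitiveL (T : ℝ) (E : Type*) [NormedAddCommGroup E] [NormedSpace ℂ E] :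
    Lp E 2 (volume.restrict (Ioo 0 T)) →L[ℂ] Lp E 2 (volume.restrict (Ioo 0 T)) :=
  LinearMap.mkContinuousOfExistsBound
    { toFun := fun f => (memLp_primitive f).toLp
      map_add' := fun f g => by
        rw [← MemLp.toLp_add, MemLp.toLp_eq_toLp_iff]
        exact (ae_restrict_iff' measurableSet_Ioo).2 (Eventually.of_forall fun t ht =>
          primitive_add f g ht.2)
      map_smul' := fun c f => by
        rw [RingHom.id_apply, ← MemLp.toLp_const_smul, MemLp.toLp_eq_toLp_iff]
        exact (ae_restrict_iff' measurableSet_Ioo).2 (Eventually.of_forall fun t ht =>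
          primitive_smul c f ht.2) }
    (by
      obtain ⟨C, hC, h⟩ := exists_integral_norm_le T E
      refine ⟨measureUnivNNReal (volume.restrict (Ioo 0 T)) ^ (2 : ℝ≥0∞).toReal⁻¹ * C, fun f => ?_⟩
      rw [mul_assoc]
      refine Lp.norm_le_of_ae_bound (by positivity) ?_
      filter_upwards [(memLp_primitive f).coeFn_toLp,
        ae_restrict_mem (measurableSet_Ioo (a := 0) (b := T))] with t h1 h2
      refine (congrArg norm h1).trans_le ?_
      exact (norm_primitive_le (integrable_of_Lp_two f) h2).trans (h f))

theorem coeFn_primitiveL (f : Lp E 2 (volume.restrict (Ioo 0 T))) :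
    primitiveL T E f =ᵐ[volume.restrict (Ioo 0 T)] fun t => ∫ s in Ioc 0 t, f s :=
  (memLp_primitive f).coeFn_toLp

theorem coeFn_const_add_primitiveL (e : E) (f : Lp E 2 (volume.restrict (Ioo 0 T))) :
    (Lp.constL 2 (volume.restrict (Ioo 0 T)) ℂ e + primitiveL T E f : Lp E 2 _)
      =ᵐ[volume.restrict (Ioo 0 T)] fun t => e + ∫ s in Ioc 0 t, f s := by
  filter_upwards [Lp.coeFn_add (Lp.constL 2 (volume.restrict (Ioo 0 T)) ℂ e) (primitiveL T E f),
    coeFn_primitiveL f, Lp.coeFn_const (p := 2) (μ := volume.restrict (Ioo 0 T)) e] with t h1 h2 h3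
  rw [h1, Pi.add_apply, h2]
  congr 1

theorem HasWeakDerivOn.congr {u u' v : ℝ → E} (h : HasWeakDerivOn T u v)
    (hu : u' =ᵐ[volume.restrict (Ioo 0 T)] u) : HasWeakDerivOn T u' v := by
  intro φ h1 h2 h3
  rw [← h φ h1 h2 h3]
  refine integral_congr_ae ?_
  filter_upwards [hu] with t ht
  rw [ht]

theorem continuousOn_const_add_primitive (e : E) (f : Lp E 2 (volume.restrict (Ioo 0 T))) :
    ContinuousOn (fun t => e + ∫ s in Ioc 0 t, f s) (Ioo 0 T) :=
  continuousOn_const.add (continuousOn_primitive_Ioo (integrable_of_Lp_two f))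

variable [CompleteSpace E]

/-- The parametrization `(e, f) ↦ (e + ∫₀ᵗ f, f)` of `H¹((0, T), E)`. -/
def h1OfDeriv (hT : 0 < T) : E × Lp E 2 (volume.restrict (Ioo 0 T)) →L[ℂ] H1 T E :=
  ((WithLp.prodContinuousLinearEquiv 2 ℂ (Lp E 2 (volume.restrict (Ioo 0 T)))
    (Lp E 2 (volume.restrict (Ioo 0 T)))).symm.toContinuousLinearMap.comp
      (((Lp.constL 2 (volume.restrict (Ioo 0 T)) ℂ).coprod (primitiveL T E)).prod
        (ContinuousLinearMap.snd ℂ E (Lp E 2 (volume.restrict (Ioo 0 T)))))).codRestrict (H1 T E)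
    fun p => (hasWeakDerivOn_primitive hT p.1 (integrable_of_Lp_two p.2)).congr
      (coeFn_const_add_primitiveL p.1 p.2)

theorem coeFn_h1OfDeriv_fst (hT : 0 < T) (e : E) (f : Lp E 2 (volume.restrict (Ioo 0 T))) :
    (h1OfDeriv hT (e, f)).1.fst =ᵐ[volume.restrict (Ioo 0 T)] fun t => e + ∫ s in Ioc 0 t, f s :=
  coeFn_const_add_primitiveL e f

/-- Subtracting from an element of `H¹` the primitive of its weak derivative leaves a function with
zero weak derivative, that is, a constant `e`. -/
theorem surjective_h1OfDeriv (hT : 0 < T) :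
    Function.Surjective (h1OfDeriv hT : E × Lp E 2 (volume.restrict (Ioo 0 T)) →L[ℂ] H1 T E) := by
  intro w
  have hf := integrable_of_Lp_two w.1.snd
  have hu := integrable_of_Lp_two w.1.fst
  have hp := hasWeakDerivOn_primitive hT 0 hf
  have hw : HasWeakDerivOn T w.1.fst w.1.snd := w.2
  obtain ⟨e, he⟩ := ae_eq_const_of_weakDeriv_eq_zero hT (hu.sub (integrable_primitive hf)) (by
    intro φ h1 h2 h3
    have hd : Continuous (deriv φ) := h1.continuous_deriv (by simp)
    have h4 := hp φ h1 h2 h3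
    simp only [zero_add] at h4
    simp only [Pi.sub_apply, smul_sub, smul_zero, integral_zero, neg_zero]
    rw [integral_sub (integrable_test_smul hd h2.deriv hu)
      (integrable_test_smul hd h2.deriv (integrable_primitive hf)), hw φ h1 h2 h3, h4, sub_self])
  refine ⟨(e, w.1.snd), Subtype.ext (WithLp.ofLp_injective 2 (Prod.ext (Lp.ext ?_) rfl))⟩
  filter_upwards [coeFn_h1OfDeriv_fst hT e w.1.snd, he] with t h1 h2
  refine h1.trans ?_
  rw [← h2, Pi.sub_apply, sub_add_cancel]
  rfl

theorem injective_h1OfDeriv (hT : 0 < T) :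
    Function.Injective (h1OfDeriv hT : E × Lp E 2 (volume.restrict (Ioo 0 T)) →L[ℂ] H1 T E) := by
  rintro ⟨e, f⟩ ⟨e', f'⟩ h
  obtain rfl : f = f' := congrArg (fun w : H1 T E => w.1.snd) h
  have h1 : (fun t => e + ∫ s in Ioc 0 t, f s) =ᵐ[volume.restrict (Ioo 0 T)]
      fun t => e' + ∫ s in Ioc 0 t, f s := by
    have h2 := coeFn_h1OfDeriv_fst hT e f
    rw [h] at h2
    exact h2.symm.trans (coeFn_h1OfDeriv_fst hT e' f)
  have h2 := Measure.eqOn_open_of_ae_eq h1 isOpen_Ioo (continuousOn_const_add_primitive e f)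
    (continuousOn_const_add_primitive e' f) (⟨by linarith, by linarith⟩ : T / 2 ∈ Ioo 0 T)
  rw [add_right_cancel h2]

theorem h1OfDeriv_mem_H1In_iff (hT : 0 < T) {S : Set E} (e : E)
    (f : Lp E 2 (volume.restrict (Ioo 0 T))) :
    h1OfDeriv hT (e, f) ∈ H1In T S ↔ ∀ t ∈ Ioo 0 T, e + ∫ s in Ioc 0 t, f s ∈ S := by
  constructor
  · rintro ⟨v, hv, hae, hS⟩ t ht
    have h := Measure.eqOn_open_of_ae_eq ((coeFn_h1OfDeriv_fst hT e f).symm.trans hae) isOpen_Ioo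
      (continuousOn_const_add_primitive e f) hv ht
    change e + ∫ s in Ioc 0 t, f s = v t at h
    rw [h]
    exact hS t ht
  · exact fun h => ⟨_, continuousOn_const_add_primitive e f, coeFn_h1OfDeriv_fst hT e f, h⟩

/-- Evaluation is clearly continuous in the coordinates `(e, f)`. The open mapping theorem, using
completeness of `H1 T E`, transfers this to the `H¹` norm. -/
theorem exists_clm_eval_h1OfDeriv (hT : 0 < T) {t : ℝ} (ht : t ∈ Ioo 0 T) :
    ∃ Λ : H1 T E →L[ℂ] E, ∀ e f, Λ (h1OfDeriv hT (e, f)) = e + ∫ s in Ioc 0 t, f s := by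
  obtain ⟨C, -, hC⟩ := exists_integral_norm_le T E
  let prim : Lp E 2 (volume.restrict (Ioo 0 T)) →L[ℂ] E := LinearMap.mkContinuous
    { toFun := fun f => ∫ s in Ioc 0 t, f s
      map_add' := fun f g => primitive_add f g ht.2
      map_smul' := fun c f => primitive_smul c f ht.2 } C
    fun f => (norm_primitive_le (integrable_of_Lp_two f) ht).trans (hC f)
  let J := ContinuousLinearEquiv.ofBijective (h1OfDeriv (E := E) hT)
    (LinearMap.ker_eq_bot.2 (injective_h1OfDeriv hT))
    (LinearMap.range_eq_top.2 (surjective_h1OfDeriv hT))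
  refine ⟨((ContinuousLinearMap.id ℂ E).coprod prim).comp J.symm.toContinuousLinearMap,
    fun e f => ?_⟩
  have h : J.symm (h1OfDeriv hT (e, f)) = (e, f) := J.symm_apply_apply (e, f)
  exact congrArg ((ContinuousLinearMap.id ℂ E).coprod prim) h

/-- `H1In T S` is the intersection over `t` of the preimages of `S` under evaluation, and a
norm-continuous linear map is also continuous for the weak topologies. -/
theorem isClosed_toWeakSpace_H1In (hT : 0 < T) {S : Set E}
    (hS : IsClosed (toWeakSpace ℂ E '' S)) : IsClosed (toWeakSpace ℂ (H1 T E) '' H1In T S) := by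
  choose Λ hΛ using fun t : Ioo 0 T => exists_clm_eval_h1OfDeriv (E := E) hT t.2
  have h : toWeakSpace ℂ (H1 T E) '' H1In T S =
      ⋂ t, WeakSpace.map (Λ t) ⁻¹' (toWeakSpace ℂ E '' S) := by
    ext w
    obtain ⟨w, rfl⟩ := (toWeakSpace ℂ (H1 T E)).surjective w
    obtain ⟨⟨e, f⟩, rfl⟩ := surjective_h1OfDeriv hT w
    rw [(toWeakSpace ℂ (H1 T E)).injective.mem_set_image, h1OfDeriv_mem_H1In_iff, mem_iInter]
    refine ⟨fun h t => ⟨_, h t t.2, congrArg (toWeakSpace ℂ E) (hΛ t e f).symm⟩,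
      fun h t ht => ?_⟩
    obtain ⟨x, hx, hxe⟩ := h ⟨t, ht⟩
    have h2 : x = Λ ⟨t, ht⟩ (h1OfDeriv hT (e, f)) := hxe
    rwa [h2, hΛ] at hx
  rw [h]
  exact isClosed_iInter fun t => hS.preimage (WeakSpace.map (Λ t)).continuous

/-- The vector `c` times the indicator of a set, as a continuous linear function of `c`. -/
def indicatorConstL {B : Set ℝ} (hB : MeasurableSet B) :
    E →L[ℂ] Lp E 2 (volume.restrict (Ioo 0 T)) :=
  LinearMap.mkContinuous
    { toFun := fun e => indicatorConstLp 2 hB (measure_ne_top (volume.restrict (Ioo 0 T)) B) e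
      map_add' := fun _ _ => indicatorConstLp_add.symm
      map_smul' := fun c e => by
        refine Lp.ext ?_
        rw [RingHom.id_apply]
        filter_upwards [indicatorConstLp_coeFn (p := 2) (hs := hB)
            (hμs := measure_ne_top (volume.restrict (Ioo 0 T)) B) (c := c • e),
          indicatorConstLp_coeFn (p := 2) (hs := hB)
            (hμs := measure_ne_top (volume.restrict (Ioo 0 T)) B) (c := e),
          Lp.coeFn_smul c (indicatorConstLp 2 hB
            (measure_ne_top (volume.restrict (Ioo 0 T)) B) e)] with t h1 h2 h3
        rw [h1, h3, Pi.smul_apply, h2, indicator_const_smul_apply] }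
    ((volume.restrict (Ioo 0 T)).real B ^ (1 / (2 : ℝ≥0∞).toReal))
    fun e => by
      rw [mul_comm]
      exact norm_indicatorConstLp_le (hs := hB)
        (hμs := measure_ne_top (volume.restrict (Ioo 0 T)) B)

/-- The primitive never leaves the line `ℂ e`; stability of `S` under scalars, without any sums,
then keeps it in `S`. -/
theorem exists_primitive_indicatorConstL {B : Set ℝ} (hB : MeasurableSet B) (e : E) {t : ℝ}
    (ht : t < T) : ∃ c : ℂ,
      ∫ s in Ioc 0 t, (indicatorConstL hB e : Lp E 2 (volume.restrict (Ioo 0 T))) s = c • e := by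
  refine ⟨((volume.restrict (Ioc 0 t)).real B : ℂ), ?_⟩
  have h : (indicatorConstL hB e : Lp E 2 (volume.restrict (Ioo 0 T)))
      =ᵐ[volume.restrict (Ioo 0 T)] B.indicator fun _ => e :=
    indicatorConstLp_coeFn (hs := hB) (hμs := measure_ne_top (volume.restrict (Ioo 0 T)) B)
  rw [primitive_congr_ae h ht, integral_indicator_const e hB, Complex.coe_smul]

theorem dense_span_H1In (hT : 0 < T) {S : Set E} (hS : IsDictionary S) :
    Dense (Submodule.span ℂ (H1In T S) : Set (H1 T E)) := by
  rw [Submodule.dense_iff_topologicalClosure_eq_top, Submodule.eq_top_iff']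
  intro w
  set V := (Submodule.span ℂ (H1In T S)).topologicalClosure with hV
  have hVc : IsClosed (V : Set (H1 T E)) := Submodule.isClosed_topologicalClosure _
  -- A continuous linear map sending `S` into `H1In T S` sends the closed span of `S`, which is all
  -- of `E`, into `V`.
  have hext : ∀ L : E →L[ℂ] H1 T E, (∀ x ∈ S, L x ∈ H1In T S) → ∀ x, L x ∈ V := by
    intro L hL x
    have h1 : Submodule.span ℂ S ≤ V.comap L.toLinearMap :=
      Submodule.span_le.2 fun y hy =>
        Submodule.le_topologicalClosure _ (Submodule.subset_span (hL y hy))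
    have h2 : IsClosed {y | L y ∈ V} := hVc.preimage L.continuous
    exact (h2.closure_subset_iff.2 h1) (hS.dense_span x)
  obtain ⟨⟨e, f⟩, rfl⟩ := surjective_h1OfDeriv hT w
  have hconst : h1OfDeriv hT (e, 0) ∈ V := by
    refine hext ((h1OfDeriv hT).comp (ContinuousLinearMap.inl ℂ E _)) (fun x hx => ?_) e
    refine (h1OfDeriv_mem_H1In_iff hT x 0).2 fun t ht => ?_
    rw [primitive_congr_ae (Lp.coeFn_zero E 2 _) ht.2]
    simpa using hx
  have hder : h1OfDeriv hT (0, f) ∈ V := by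
    -- Simple functions reduce the claim to `x 1_B`, and `hext` reduces it further to `x ∈ S`.
    refine Lp.induction (p := 2) (by norm_num)
      (motive := fun f => h1OfDeriv hT ((0 : E), f) ∈ V) ?_ ?_ ?_ f
    · intro x B hB hμB
      refine hext ((h1OfDeriv hT).comp ((ContinuousLinearMap.inr ℂ E _).comp
        (indicatorConstL hB))) (fun y hy => ?_) x
      refine (h1OfDeriv_mem_H1In_iff hT 0 _).2 fun t ht => ?_
      obtain ⟨c, hc⟩ := exists_primitive_indicatorConstL hB y ht.2
      change 0 + ∫ s in Ioc 0 t, (indicatorConstL hB y : Lp E 2 (volume.restrict (Ioo 0 T))) s ∈ S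
      rw [hc, zero_add]
      exact hS.smul_mem y hy c
    · intro f g hf hg _ h1 h2
      have : ((0 : E), hf.toLp f + hg.toLp g) = (0, hf.toLp f) + (0, hg.toLp g) := by simp
      rw [this, map_add]
      exact V.add_mem h1 h2
    · exact hVc.preimage ((h1OfDeriv hT).continuous.comp (Continuous.prodMk_right 0))
  have : (e, f) = (e, 0) + (0, f) := by simp
  rw [this, map_add]
  exact V.add_mem hconst hder

theorem IsDictionary.h1In (hT : 0 < T) {S : Set E} (hS : IsDictionary S) :
    IsDictionary (H1In T S) where
  smul_mem w hw c := by
    obtain ⟨⟨e, f⟩, rfl⟩ := surjective_h1OfDeriv hT w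
    rw [← map_smul, Prod.smul_mk, h1OfDeriv_mem_H1In_iff]
    rw [h1OfDeriv_mem_H1In_iff] at hw
    intro t ht
    rw [primitive_smul c f ht.2, ← smul_add]
    exact hS.smul_mem _ (hw t ht) c
  weakly_closed := isClosed_toWeakSpace_H1In hT hS.weakly_closed
  dense_span := dense_span_H1In hT hS

end Sobolev

end

theorem mainTheorem1 (d : ℕ) (hd : 1 ≤ d) (ν : Fin d → ℕ) :
    (∀ (r : ℝ≥0∞) [Fact (1 ≤ r)], r ≠ ⊤ →
      (∀ f ∈ polyGaussianPackets ν, MemLp f r volume) ∧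
      IsDictionary (polyGaussianLp ν r)) ∧
    (∀ T : ℝ, 0 < T → IsDictionary (H1In T (polyGaussianLp ν 2))) := by
  have hL : ∀ (r : ℝ≥0∞) [Fact (1 ≤ r)], r ≠ ⊤ →
      IsDictionary (polyGaussianLp ν r) := fun r _ hr => isDictionary_polyGaussianLp ν hr
  exact ⟨fun r _ hr => ⟨fun f hf => memLp_of_mem_polyGaussianPackets hr hf, hL r hr⟩,
    fun T hT => (hL 2 (by norm_num)).h1In hT⟩
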